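/- **Notation.** Let $\mathcal A=\{a(k,d)\mid k\ge 1,\ d\ge 0\}$ be an alphabet, and let $\mathbb Q\langle\mathcal A\rangle$ be the $\mathbb Q$-vector space with basis the words in $\mathcal A$ (including the empty word $1$). The *stuffle product* $\ast$ on $\mathbb Q\langle\mathcal A\rangle$ is the $\mathbb Q$-bilinear product with $1\ast w=w\ast 1=w$ and $$a(k_1,d_1)w\ast a(k_2,d_2)v=a(k_1,d_1)\bigl(w\ast a(k_2,d_2)v\bigr)+a(k_2,d_2)\bigl(a(k_1,d_1)w\ast v\bigr)+a(k_1+k_2,d_1+d_2)(w\ast v)$$ for letters $a(k_i,d_i)$ and words $w,v$; it makes $\mathbb Q\langle\mathcal A\rangle$ a commutative $\mathbb Q$-algebra. For $r\ge 0$ put $$\mathfrak A_r\binom{X_1,\dots,X_r}{Y_1,\dots,Y_r}=\sum_{\substack{k_1,\dots,k_r\ge1\\ d_1,\dots,d_r\ge0}}a(k_1,d_1)\cdots a(k_r,d_r)\,X_1^{k_1-1}\cdots X_r^{k_r-1}\frac{Y_1^{d_1}}{d_1!}\cdots\frac{Y_r^{d_r}}{d_r!}.$$ The *swap* is the $\mathbb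 Q$-linear map $\sigma:\mathbb Q\langle\mathcal A\rangle\to\mathbb Q\langle\mathcal A\rangle$ which sends the word $a(k_1,d_1)\cdots a(k_r,d_r)$ to the coefficient of $X_1^{k_1-1}\cdots X_r^{k_r-1}\frac{Y_1^{d_1}}{d_1!}\cdots\frac{Y_r^{d_r}}{d_r!}$ in $$\mathfrak A_r\binom{Y_1+\dots+Y_r,\ \dots,\ Y_1+Y_2,\ Y_1}{X_r,\ X_{r-1}-X_r,\ \dots,\ X_1-X_2}.$$ The algebra of *formal multiple Eisenstein series* is the quotient $\mathcal G^f=(\mathbb Q\langle\mathcal A\rangle,\ast)/\mathfrak S$, where $\mathfrak S$ is the ideal generated by $\sigma(w)-w$ for all $w\in\mathbb Q\langle\mathcal A\rangle$. Write $G^f(k_1,\dots,k_r)$ for the class of $a(k_1,0)\cdots a(k_r,0)$. Let $\mathfrak N$ be the ideal of $(\mathbb Q\langle\mathcal A\rangle,\ast)$ generated by all words that are *not* of the form $a(1,d_1)\cdots a(1,d_s)\,a(k_1,0)\cdots a(k_r,0)$ with $r,s\ge0$, $k_i\ge1$, $d_i\ge0$. The algebra of *formal multiple zeta values* $\mathcal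 Z^f$ is the quotient of $\mathcal G^f$ by the image of $\mathfrak N$, and $\zeta^f(k_1,\dots,k_r)\in\mathcal Z^f$ is the class of $G^f(k_1,\dots,k_r)$. Let $\mathfrak H^1=\mathbb Q\langle z_k\mid k\ge1\rangle$, with the stuffle product given by $1\ast w=w\ast 1=w$ and $z_iw\ast z_jv=z_i(w\ast z_jv)+z_j(z_iw\ast v)+z_{i+j}(w\ast v)$, and let $\mathfrak H^0\subset\mathfrak H^1$ be the subalgebra generated by all words that do not start in $z_1$. Identifying $z_k$ with $x^{k-1}y$ embeds $\mathfrak H^1$ into $\mathbb Q\langle x,y\rangle$; its image is closed under the shuffle product $⧢$ of words in the letters $x,y$, so that $⧢$ is also a product on $\mathfrak H^1$. The $\mathbb Q$-linear map $$\zeta^f:\mathfrak H^1\to\mathcal Z^f,\qquad z_{k_1}\cdots z_{k_r}\mapsto\zeta^f(k_1,\dots,k_r)$$ is a homomorphism of algebras for the stuffle product on $\mathfrak H^1$. **Theorem.** The formal multiple zeta values satisfy exactly the extended double shuffle relations: the kernel of $\zeta^f:\mathfrak H^1\to\mathcal Z^f$ is the ideal of $(\mathfrak H^1,\ast)$ generated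 by the elements $w\ast v-w\,⧢\,v$ with $w\in\mathfrak H^1$ and $v\in\mathfrak H^0$. -/

import Mathlib

noncomputable section

/-- The `ℚ`-vector space `ℚ⟨L⟩` with basis the words in the alphabet `L`. For an alphabet with a
commutative and associative addition, it is made a commutative ring below by the *stuffle product*;
the product of this ring is never the concatenation. -/
def Stuffle (L : Type) : Type := List L →₀ ℚ

namespace Stuffle

variable {L L' : Type}

instance : AddCommGroup (Stuffle L) := inferInstanceAs (AddCommGroup (List L →₀ ℚ))
instance : Module ℚ (Stuffle L) := inferInstanceAs (Module ℚ (List L →₀ ℚ))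

/-- A word, as an element of `ℚ⟨L⟩`. -/
def word (w : List L) : Stuffle L := Finsupp.single w 1

/-- The linear map on `ℚ⟨L⟩` with prescribed values on words. -/
def lift {M : Type*} [AddCommGroup M] [Module ℚ M] (f : List L → M) : Stuffle L →ₗ[ℚ] M :=
  Finsupp.linearCombination ℚ f

@[simp] lemma lift_word {M : Type*} [AddCommGroup M] [Module ℚ M] (f : List L → M) (w : List L) :
    lift f (word w) = f w := by
  unfold lift word
  erw [Finsupp.linearCombination_single]
  simp

lemma hom_ext {M : Type*} [AddCommGroup M] [Module ℚ M] {f g : Stuffle L →ₗ[ℚ] M}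
    (h : ∀ w, f (word w) = g (word w)) : f = g :=
  Finsupp.lhom_ext' fun w => LinearMap.ext_ring (h w)

/-- Concatenation with a letter on the left. -/
def cons (a : L) : Stuffle L →ₗ[ℚ] Stuffle L := lift fun w => word (a :: w)

@[simp] lemma cons_word (a : L) (w : List L) : cons a (word w) = word (a :: w) := by
  simp [cons]

/-- The empty word is the unit element. -/
instance : One (Stuffle L) := ⟨word []⟩

lemma one_def : (1 : Stuffle L) = word [] := rfl

/-- The shuffle product of two words. -/
def shuffleWord : List L → List L → Stuffle L
  | [], v => word v
  | a :: u, [] => word (a :: u)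
  | a :: u, b :: v => cons a (shuffleWord u (b :: v)) + cons b (shuffleWord (a :: u) v)
termination_by u v => u.length + v.length

/-- The shuffle product on `ℚ⟨L⟩`, as a bilinear map. -/
def shuffle : Stuffle L →ₗ[ℚ] Stuffle L →ₗ[ℚ] Stuffle L :=
  lift fun u => lift fun v => shuffleWord u v

section Product

variable [AddCommSemigroup L] [AddCommSemigroup L']

/-- The stuffle product of two words. -/
def stuffleWord : List L → List L → Stuffle L
  | [], v => word v
  | a :: u, [] => word (a :: u)
  | a :: u, b :: v =>
      cons a (stuffleWord u (b :: v)) + cons b (stuffleWord (a :: u) v)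
        + cons (a + b) (stuffleWord u v)
termination_by u v => u.length + v.length

/-- The stuffle product on `ℚ⟨L⟩`, as a bilinear map. -/
def stuffle : Stuffle L →ₗ[ℚ] Stuffle L →ₗ[ℚ] Stuffle L :=
  lift fun u => lift fun v => stuffleWord u v

instance : Mul (Stuffle L) := ⟨fun x y => stuffle x y⟩

lemma mul_def (x y : Stuffle L) : x * y = stuffle x y := rfl

lemma word_mul_word (u v : List L) : word u * word v = stuffleWord u v := by
  simp [mul_def, stuffle]

lemma stuffle_comm : (stuffle : Stuffle L →ₗ[ℚ] _) = stuffle.flip := by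
  have key : ∀ (n : ℕ) (u v : List L), u.length + v.length = n →
      stuffleWord u v = stuffleWord v u := by
    intro n
    induction n using Nat.strong_induction_on with
    | _ n ih =>
      intro u v h
      match u, v with
      | [], [] => rfl
      | [], b :: v => simp [stuffleWord]
      | a :: u, [] => simp [stuffleWord]
      | a :: u, b :: v =>
        simp only [List.length_cons] at h
        rw [stuffleWord, stuffleWord, ih _ (by simp; omega) u (b :: v) rfl,
          ih _ (by simp; omega) (a :: u) v rfl, ih _ (by omega) u v rfl, add_comm a b]
        abel
  refine hom_ext fun u => hom_ext fun v => ?_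
  simpa [stuffle] using key _ u v rfl

lemma stuffle_cons_cons (a b : L) (x y : Stuffle L) :
    stuffle (cons a x) (cons b y) = cons a (stuffle x (cons b y)) + cons b (stuffle (cons a x) y)
      + cons (a + b) (stuffle x y) := by
  have h : (stuffle.compl₂ (cons b)).comp (cons a)
      = (stuffle.compl₂ (cons b)).compr₂ (cons a) + (stuffle.comp (cons a)).compr₂ (cons b)
        + stuffle.compr₂ (cons (a + b)) := by
    refine hom_ext fun u => hom_ext fun v => ?_
    simp only [LinearMap.comp_apply, LinearMap.compl₂_apply, LinearMap.add_apply,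
      LinearMap.compr₂_apply, cons_word]
    simp [stuffle, stuffleWord]
  exact congrArg (fun f => f x y) h

lemma stuffle_nil_left (x : Stuffle L) : stuffle (word []) x = x := by
  have h : stuffle (word ([] : List L)) = LinearMap.id :=
    hom_ext fun v => by simp [stuffle, stuffleWord]
  rw [h]; rfl

lemma stuffle_comm_apply (x y : Stuffle L) : stuffle x y = stuffle y x :=
  congrArg (fun f => f x y) stuffle_comm

lemma stuffle_nil_right (x : Stuffle L) : stuffle x (word []) = x := by
  rw [stuffle_comm_apply, stuffle_nil_left]

lemma stuffle_assoc (x y z : Stuffle L) :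
    stuffle (stuffle x y) z = stuffle x (stuffle y z) := by
  have key : ∀ (n : ℕ) (u v w : List L), u.length + v.length + w.length = n →
      stuffle (stuffle (word u) (word v)) (word w)
        = stuffle (word u) (stuffle (word v) (word w)) := by
    intro n
    induction n using Nat.strong_induction_on with
    | _ n ih =>
      intro u v w h
      match u, v, w with
      | [], v, w => simp [stuffle_nil_left]
      | a :: u, [], w => simp [stuffle_nil_left, stuffle_nil_right]
      | a :: u, b :: v, [] => simp [stuffle_nil_right]
      | a :: u, b :: v, c :: w =>
        simp only [List.length_cons] at h
        have h1 := ih _ (by simp; omega) u (b :: v) (c :: w) rfl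
        have h2 := ih _ (by simp; omega) (a :: u) v (c :: w) rfl
        have h3 := ih _ (by simp; omega) (a :: u) (b :: v) w rfl
        have h4 := ih _ (by simp; omega) u v (c :: w) rfl
        have h5 := ih _ (by simp; omega) u (b :: v) w rfl
        have h6 := ih _ (by simp; omega) (a :: u) v w rfl
        have h7 := ih _ (by omega) u v w rfl
        simp only [← cons_word] at h1 h2 h3 h4 h5 h6 ⊢
        have e1 := stuffle_cons_cons a b (word u) (word v)
        have e2 := stuffle_cons_cons b c (word v) (word w)
        rw [e2] at h1
        rw [e1] at h3
        rw [e1, e2]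
        simp only [map_add, LinearMap.add_apply] at h1 h3 ⊢
        have h1' := congrArg (cons a) h1
        have h3' := congrArg (cons c) h3
        simp only [map_add] at h1' h3'
        rw [stuffle_cons_cons a c (stuffle (word u) (cons b (word v))) (word w),
          stuffle_cons_cons b c (stuffle (cons a (word u)) (word v)) (word w),
          stuffle_cons_cons (a + b) c (stuffle (word u) (word v)) (word w),
          stuffle_cons_cons a b (word u) (stuffle (word v) (cons c (word w))),
          stuffle_cons_cons a c (word u) (stuffle (cons b (word v)) (word w)),
          stuffle_cons_cons a (b + c) (word u) (stuffle (word v) (word w)),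
          h2, h4, h5, h6, h7, add_assoc a b c]
        have h := congrArg₂ (fun p q => p + q) h1' h3'
        beta_reduce at h
        rw [← sub_eq_zero] at h ⊢
        rw [← h]
        abel
  have h1 : ∀ u v, stuffle (stuffle (word u) (word v)) = (stuffle (word u)).comp (stuffle (word v)) :=
    fun u v => hom_ext fun w => key _ u v w rfl
  have h2 : ∀ u, stuffle.comp (stuffle (word u))
      = (LinearMap.llcomp ℚ (Stuffle L) (Stuffle L) (Stuffle L) (stuffle (word u))).comp stuffle :=
    fun u => hom_ext fun v => h1 u v
  have h3 : (LinearMap.llcomp ℚ (Stuffle L) (Stuffle L) _ stuffle).comp stuffle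
      = (LinearMap.lcomp ℚ _ stuffle).comp
          ((LinearMap.llcomp ℚ (Stuffle L) (Stuffle L) (Stuffle L)).comp stuffle) :=
    hom_ext fun u => h2 u
  exact congrArg (fun f => f x y z) h3

instance : CommRing (Stuffle L) where
  __ := (inferInstance : AddCommGroup (Stuffle L))
  mul_assoc := stuffle_assoc
  mul_comm := stuffle_comm_apply
  one_mul := stuffle_nil_left
  mul_one := stuffle_nil_right
  left_distrib x y z := map_add (stuffle x) y z
  right_distrib x y z := LinearMap.map_add₂ stuffle x y z
  zero_mul x := LinearMap.map_zero₂ stuffle x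
  mul_zero x := map_zero (stuffle x)

instance : Algebra ℚ (Stuffle L) :=
  Algebra.ofModule (fun r x y => LinearMap.map_smul₂ stuffle r x y)
    (fun r x y => map_smul (stuffle x) r y)

/-- The linear map which replaces every letter `a` of a word by `f a`. -/
def mapLin (f : AddHom L L') : Stuffle L →ₗ[ℚ] Stuffle L' := lift fun w => word (w.map f)

lemma mapLin_cons (f : AddHom L L') (a : L) (x : Stuffle L) :
    mapLin f (cons a x) = cons (f a) (mapLin f x) := by
  have h : (mapLin f).comp (cons a) = (cons (f a)).comp (mapLin f) :=
    hom_ext fun w => by simp [mapLin]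
  exact congrArg (fun g => g x) h

lemma mapLin_mul (f : AddHom L L') (x y : Stuffle L) :
    mapLin f (x * y) = mapLin f x * mapLin f y := by
  have key : ∀ (n : ℕ) (u v : List L), u.length + v.length = n →
      mapLin f (stuffleWord u v) = stuffleWord (u.map f) (v.map f) := by
    intro n
    induction n using Nat.strong_induction_on with
    | _ n ih =>
      intro u v h
      match u, v with
      | [], v => simp [stuffleWord, mapLin]
      | a :: u, [] => simp [stuffleWord, mapLin]
      | a :: u, b :: v =>
        simp only [List.length_cons] at h
        simp only [stuffleWord, List.map_cons, map_add, mapLin_cons]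
        rw [ih _ (by simp; omega) u (b :: v) rfl, ih _ (by simp; omega) (a :: u) v rfl,
          ih _ (by omega) u v rfl, List.map_cons, List.map_cons]
  have h : stuffle.compr₂ (mapLin f) = stuffle.compl₁₂ (mapLin f) (mapLin f) := by
    refine hom_ext fun u => hom_ext fun v => ?_
    have := key _ u v rfl
    simp only [LinearMap.compr₂_apply, LinearMap.compl₁₂_apply]
    rw [← mul_def, ← mul_def, word_mul_word, this, ← word_mul_word]
    simp [mapLin]
  exact congrArg (fun g => g x y) h

/-- The homomorphism of stuffle algebras which replaces every letter `a` of a word by `f a`. -/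
def map (f : AddHom L L') : Stuffle L →ₐ[ℚ] Stuffle L' :=
  AlgHom.ofLinearMap (mapLin f) (by simp [one_def, mapLin]) (mapLin_mul f)

@[simp] lemma map_word (f : AddHom L L') (w : List L) : map f (word w) = word (w.map f) := by
  simp [map, mapLin]

end Product
end Stuffle

namespace FormalMZV

open Stuffle

/-! ### The space `𝔥¹` with its two products -/

/-- `𝔥¹ = ℚ⟨z_k ∣ k ≥ 1⟩` with the stuffle product; the letter `z_k` is the positive integer `k`. -/
abbrev H1 : Type := Stuffle ℕ+

/-- `𝔥⁰`, the subalgebra of `𝔥¹` generated by the words that do not start in `z_1`. -/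
def H0 : Subalgebra ℚ H1 := Algebra.adjoin ℚ {x | ∃ w : List ℕ+, w.head? ≠ some 1 ∧ x = word w}

/-- The letters `x` and `y`. -/
inductive XY : Type
  | x
  | y

/-- The word in `x` and `y` obtained from a word in the `z_k` by `z_k = x ^ (k - 1) y`. -/
def toXY (w : List ℕ+) : List XY :=
  w.flatMap fun k => List.replicate (k.natPred) XY.x ++ [XY.y]

/-- The identification of `𝔥¹` with a subspace of `𝔥 = ℚ⟨x, y⟩`. -/
def inclXY : H1 →ₗ[ℚ] Stuffle XY := lift fun w => word (toXY w)

/-- Reads off a word in the `z_k` from a word in `x` and `y`, where `n` letters `x` are pending. -/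
def ofXYAux : ℕ → List XY → List ℕ+
  | _, [] => []
  | n, XY.x :: w => ofXYAux (n + 1) w
  | n, XY.y :: w => n.succPNat :: ofXYAux 0 w

/-- The left inverse of `inclXY` which drops the letters `x` after the last `y` of a word. -/
def retractXY : Stuffle XY →ₗ[ℚ] H1 := lift fun w => word (ofXYAux 0 w)

/-- The shuffle product `⧢` on `𝔥¹`, i.e. the product of the two images in `𝔥 = ℚ⟨x, y⟩` for the
shuffle product in the letters `x` and `y`; see `inclXY_sh`. -/
def sh (w v : H1) : H1 := retractXY (shuffle (inclXY w) (inclXY v))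

lemma ofXYAux_toXY (w : List ℕ+) : ofXYAux 0 (toXY w) = w := by
  have h : ∀ (n m : ℕ) (l : List XY), ofXYAux m (List.replicate n XY.x ++ XY.y :: l)
      = (m + n).succPNat :: ofXYAux 0 l := by
    intro n
    induction n with
    | zero => intro m l; simp [ofXYAux]
    | succ n ih => intro m l; rw [List.replicate_succ, List.cons_append, ofXYAux, ih, add_right_comm, add_assoc]
  induction w with
  | nil => rfl
  | cons k w ih =>
    have : toXY (k :: w) = List.replicate k.natPred XY.x ++ XY.y :: toXY w := by simp [toXY]
    rw [this, h, ih]; simp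

lemma retractXY_inclXY (w : H1) : retractXY (inclXY w) = w := by
  have h : retractXY.comp inclXY = LinearMap.id :=
    hom_ext fun w => by simp [retractXY, inclXY, ofXYAux_toXY]
  exact congrArg (fun f => f w) h

lemma toXY_ofXYAux (l : List XY) (hl : l.getLast? = some XY.y) :
    ∀ n, toXY (ofXYAux n l) = List.replicate n XY.x ++ l := by
  induction l with
  | nil => simp at hl
  | cons a l ih =>
    intro n
    have hl' : l ≠ [] → l.getLast? = some XY.y := fun h => by
      rwa [List.getLast?_cons_of_ne_nil h] at hl
    cases a with
    | x =>
      have hne : l ≠ [] := by rintro rfl; simp at hl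
      rw [ofXYAux, ih (hl' hne)]
      simp [List.replicate_succ']
    | y =>
      have h0 : toXY (ofXYAux 0 l) = l := by
        rcases eq_or_ne l [] with rfl | hne
        · rfl
        · simpa using ih (hl' hne) 0
      have : toXY (ofXYAux n (XY.y :: l))
          = List.replicate n XY.x ++ XY.y :: toXY (ofXYAux 0 l) := by simp [ofXYAux, toXY]
      rw [this, h0]

lemma shuffleWord_mem_span : ∀ (n : ℕ) (u v : List XY), u.length + v.length = n →
    (u = [] ∨ u.getLast? = some XY.y) → (v = [] ∨ v.getLast? = some XY.y) →
    (u = [] → v ≠ []) →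
    shuffleWord u v ∈ Submodule.span ℚ (word '' {l : List XY | l.getLast? = some XY.y}) := by
  have hcons : ∀ (a : XY) (z : Stuffle XY),
      z ∈ Submodule.span ℚ (word '' {l : List XY | l.getLast? = some XY.y}) →
      cons a z ∈ Submodule.span ℚ (word '' {l : List XY | l.getLast? = some XY.y}) := by
    intro a z hz
    refine (Submodule.span_le (p := (Submodule.span ℚ
      (word '' {l : List XY | l.getLast? = some XY.y})).comap (cons a))).2 ?_ hz
    rintro _ ⟨l, hl, rfl⟩
    have hne : l ≠ [] := by rintro rfl; simp at hl
    refine Submodule.subset_span ⟨a :: l, ?_, by simp⟩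
    change (a :: l).getLast? = _
    rwa [List.getLast?_cons_of_ne_nil hne]
  have htail : ∀ (a : XY) (l : List XY), (a :: l = [] ∨ (a :: l).getLast? = some XY.y) →
      (l = [] ∨ l.getLast? = some XY.y) := by
    intro a l h
    rcases eq_or_ne l [] with rfl | hne
    · exact Or.inl rfl
    · rw [List.getLast?_cons_of_ne_nil hne] at h
      exact Or.inr (h.resolve_left (by simp))
  intro n
  induction n using Nat.strong_induction_on with
  | _ n ih =>
    intro u v h hu hv hne
    match u, v with
    | [], v =>
      rw [shuffleWord]
      exact Submodule.subset_span ⟨v, hv.resolve_left (hne rfl), rfl⟩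
    | a :: u, [] =>
      rw [shuffleWord]
      exact Submodule.subset_span ⟨a :: u, hu.resolve_left (by simp), rfl⟩
    | a :: u, b :: v =>
      simp only [List.length_cons] at h
      rw [shuffleWord]
      exact Submodule.add_mem _
        (hcons _ _ (ih _ (by simp; omega) u (b :: v) rfl (htail _ _ hu) hv (by simp)))
        (hcons _ _ (ih _ (by simp; omega) (a :: u) v rfl hu (htail _ _ hv) (by simp)))

/-- `𝔥¹` is closed under the shuffle product of `ℚ⟨x, y⟩`, and `sh` is its restriction. -/
lemma inclXY_sh (w v : H1) : inclXY (sh w v) = shuffle (inclXY w) (inclXY v) := by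
  have hgood : ∀ w : List ℕ+, toXY w = [] ∨ (toXY w).getLast? = some XY.y := by
    intro w
    induction w using List.reverseRecOn with
    | nil => exact Or.inl rfl
    | append_singleton w k _ => right; simp [toXY]
  have hspan : ∀ z ∈ Submodule.span ℚ (word '' {l : List XY | l.getLast? = some XY.y}),
      inclXY (retractXY z) = z := by
    intro z hz
    refine (Submodule.span_le (p := LinearMap.eqLocus (inclXY.comp retractXY)
      LinearMap.id)).2 ?_ hz
    rintro _ ⟨l, hl, rfl⟩
    simp only [SetLike.mem_coe, LinearMap.mem_eqLocus, LinearMap.comp_apply, LinearMap.id_apply]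
    have := toXY_ofXYAux l hl 0
    simp only [List.replicate_zero, List.nil_append] at this
    simp [inclXY, retractXY, this]
  have h : (shuffle.compl₁₂ inclXY inclXY).compr₂ (inclXY.comp retractXY)
      = shuffle.compl₁₂ inclXY inclXY := by
    refine hom_ext fun u => hom_ext fun v => ?_
    simp only [LinearMap.compr₂_apply, LinearMap.compl₁₂_apply, LinearMap.comp_apply]
    have e : shuffle (inclXY (word u)) (inclXY (word v)) = shuffleWord (toXY u) (toXY v) := by
      simp [inclXY, shuffle]
    rw [e]
    by_cases hne : toXY u = [] → toXY v ≠ []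
    · exact hspan _ (shuffleWord_mem_span _ _ _ rfl (hgood u) (hgood v) hne)
    · push Not at hne
      rw [hne.1, hne.2, shuffleWord]
      simp [inclXY, retractXY, ofXYAux, toXY]
  exact congrArg (fun g => g w v) h

/-! ### Formal multiple Eisenstein series -/

/-- The letter with upper index `k ≥ 1` and lower index `d ≥ 0` is the pair `(k, d)`. -/
abbrev Letter : Type := ℕ+ × ℕ

/-- `ℚ⟨𝒜⟩` with the stuffle product. -/
abbrev QA : Type := Stuffle Letter

/-- The generating series `𝔄_r` of the words of length `r`; the variables `X_j` and `Y_j` are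
indexed by `Sum.inl j` and `Sum.inr j`. -/
def genSeries (r : ℕ) : MvPowerSeries (Fin r ⊕ Fin r) QA := fun m =>
  (∏ j, ((m (Sum.inr j)).factorial : ℚ))⁻¹ •
    word (List.ofFn fun j : Fin r => ((m (Sum.inl j)).succPNat, m (Sum.inr j)))

lemma coeff_genSeries (r : ℕ) (m : (Fin r ⊕ Fin r) →₀ ℕ) :
    MvPowerSeries.coeff m (genSeries r) = (∏ j, ((m (Sum.inr j)).factorial : ℚ))⁻¹ •
      word (List.ofFn fun j : Fin r => ((m (Sum.inl j)).succPNat, m (Sum.inr j))) := rfl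

/-- The change of variables of the swap, with `j` counted from `0`: `X_j` is replaced by
`Y_0 + ⋯ + Y_(r-1-j)`, and `Y_j` by `X_(r-1-j) - X_(r-j)`, where `X_r = 0`. -/
def swapVar (R : Type) [CommRing R] (r : ℕ) : Fin r ⊕ Fin r → MvPowerSeries (Fin r ⊕ Fin r) R :=
  Sum.elim
    (fun j => ∑ i ∈ Finset.Iic j.rev, MvPowerSeries.X (Sum.inr i))
    (fun j => MvPowerSeries.X (Sum.inl j.rev) -
      if h : j.rev.val + 1 < r then MvPowerSeries.X (Sum.inl ⟨j.rev.val + 1, h⟩) else 0)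

/-- The substitution of the swap is an admissible one for power series. -/
lemma hasSubst_swapVar (R : Type) [CommRing R] (r : ℕ) :
    MvPowerSeries.HasSubst (swapVar R r) := by
  refine MvPowerSeries.hasSubst_of_constantCoeff_zero fun s => ?_
  rcases s with j | j
  · simp [swapVar]
  · by_cases h : j.rev.val + 1 < r <;> simp [swapVar, -Fin.val_rev, h]

/-- The swap of a power series in the variables `X_j`, `Y_j`. -/
def swapSeries {R : Type} [CommRing R] {r : ℕ} (f : MvPowerSeries (Fin r ⊕ Fin r) R) :
    MvPowerSeries (Fin r ⊕ Fin r) R :=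
  MvPowerSeries.subst (swapVar R r) f

/-- The exponent of `∏ X_j ^ (k_j - 1) Y_j ^ d_j` for the word with letters `(k_j, d_j)`. -/
def exponent (w : List Letter) : (Fin w.length ⊕ Fin w.length) →₀ ℕ :=
  Finsupp.equivFunOnFinite.symm
    (Sum.elim (fun j => (w.get j).1.natPred) (fun j => (w.get j).2))

/-- The swap `σ` on `ℚ⟨𝒜⟩`: the image of the word with letters `(k_j, d_j)` is the coefficient of
`∏ X_j ^ (k_j - 1) Y_j ^ d_j / d_j!` in the swap of the generating series. -/
def swap : QA →ₗ[ℚ] QA :=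
  lift fun w => (∏ j, ((w.get j).2.factorial : ℚ)) •
    MvPowerSeries.coeff (exponent w) (swapSeries (genSeries w.length))

/-- The ideal generated by all `σ(w) - w`. -/
def swapIdeal : Ideal QA := Ideal.span (Set.range fun w => swap w - w)

/-- The algebra of formal multiple Eisenstein series. -/
abbrev FMES : Type := QA ⧸ swapIdeal

/-- The formal multiple Eisenstein series `G^f(w)` of a word `w`. -/
def Gf (w : List Letter) : FMES := Ideal.Quotient.mk swapIdeal (word w)

/-! ### Formal multiple zeta values -/

/-- The words of the form `(1, d_1) ⋯ (1, d_s) (k_1, 0) ⋯ (k_r, 0)` with `r, s ≥ 0`. -/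
def IsZetaWord (w : List Letter) : Prop :=
  ∃ u v : List Letter, w = u ++ v ∧ (∀ a ∈ u, a.1 = 1) ∧ ∀ a ∈ v, a.2 = 0

/-- The ideal `𝔑` of `ℚ⟨𝒜⟩` generated by all other words. -/
def idealN : Ideal QA := Ideal.span {x | ∃ w : List Letter, ¬ IsZetaWord w ∧ x = word w}

/-- The algebra of formal multiple zeta values: the quotient of `FMES` by the image of `𝔑`. -/
abbrev Zf : Type := FMES ⧸ idealN.map (Ideal.Quotient.mk swapIdeal)

/-- The projection from formal multiple Eisenstein series to formal multiple zeta values. -/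
def proj : FMES →ₐ[ℚ] Zf := Ideal.Quotient.mkₐ ℚ _

/-- The inclusion `z_{k_1} ⋯ z_{k_r} ↦ (k_1, 0) ⋯ (k_r, 0)` of `𝔥¹` into `ℚ⟨𝒜⟩`. -/
def inclQA : H1 →ₐ[ℚ] QA := Stuffle.map ⟨fun k => (k, 0), fun _ _ => rfl⟩

/-- The stuffle homomorphism `ζ^f : 𝔥¹ → Z^f`. -/
def zetaF : H1 →ₐ[ℚ] Zf := proj.comp ((Ideal.Quotient.mkₐ ℚ swapIdeal).comp inclQA)

/-- `ζ^f` maps `z_{k_1} ⋯ z_{k_r}` to the class of `G^f(k_1, …, k_r)`. -/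
lemma zetaF_word (w : List ℕ+) : zetaF (word w) = proj (Gf (w.map fun k => (k, 0))) := by
  simp [zetaF, inclQA, Gf]

end FormalMZV

end

noncomputable section

/-! ### Words, the shuffle recursion and the coefficient of the empty word. -/

namespace Stuffle

variable {L : Type}

/-! Everything rests on one linear map `theta` from words in the lower indices to `𝔥¹`. The swap of
`a(1,d_1)⋯a(1,d_r)` involves only words with lower indices `0`, and `theta` is that swap
(`swap_inclLow`). Read as a polynomial, `theta` of `d_1⋯d_r` is `∏ (X_1 + ⋯ + X_{r+1-i})^{d_i}`. Its
image is all of `𝔥¹`, and it carries the shuffle of words in the lower indices to `⧢`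
(`theta_shuffle`), since removing a first letter `x` or `y` from `theta` corresponds to the
derivations `der` and `trim`.

The relations hold: a stuffle of two words with upper indices `1` is their shuffle plus words
containing an upper index above `1`. The latter lie in `𝔑` when one factor does not end in `(1,0)`
(`inclLow_mul_sub_mem`). Applying the swap turns this into `w ∗ v = w ⧢ v` for `ζ^f`, and the words
not ending in `0` are enough to reach `𝔥⁰` (`zetaF_mul_eq_sh`).

There are no others: let `c` be any stuffle homomorphism on `𝔥¹` satisfying the relations, for
instance the projection modulo their ideal. It suffices to extend `c` to `ℚ⟨𝒜⟩` so that `𝔑` is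
killed and the swap acts trivially. The extension is a convolution along deconcatenation: a prefix
with upper indices `1` is evaluated through `theta`, a suffix with lower indices `0` by `c`. As the
letter `(1,0)` fits both sides, the prefix value is first regularized to vanish at `(1,0)`, by
dividing by the generating series of the `c(z_1^j)`. The relations make this regularization `lowReg`
multiplicative (`lowReg_shuffle`).

Invariance under the swap: `ℚ⟨𝒜⟩` is spanned by the elements `zipWord u (theta v)`. The swap is the
transpose of its linear change of variables and exchanges `u` and `v` (`swap_zipWord_theta`), while
the extension takes on them a value symmetric in `u` and `v` (`extension_zipWord_theta`). -/

lemma induction_word {motive : Stuffle L → Prop} (x : Stuffle L)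
    (add : ∀ x y, motive x → motive y → motive (x + y))
    (smul_word : ∀ (c : ℚ) w, motive (c • word w)) : motive x := by
  have h : ∀ (w : List L) (c : ℚ), (Finsupp.single w c : List L →₀ ℚ) = c • word w := by
    intro w c
    exact (by simp : (Finsupp.single w c : List L →₀ ℚ) = c • Finsupp.single w 1)
  refine Finsupp.induction_linear x ?_ add fun w c => h w c ▸ smul_word c w
  have := smul_word 0 []
  rwa [zero_smul] at this

lemma map_mem_of_forall_word {M : Type*} [AddCommGroup M] [Module ℚ M] (f : Stuffle L →ₗ[ℚ] M)
    {S : Submodule ℚ M} (h : ∀ w, f (word w) ∈ S) (x : Stuffle L) : f x ∈ S := by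
  have : S.mkQ.comp f = 0 := hom_ext fun w => by simpa using h w
  simpa using congrArg (fun g => g x) this

lemma map_mem_of_mem_span {M : Type*} [AddCommGroup M] [Module ℚ M] {A : Set (List L)}
    {x : Stuffle L} (hx : x ∈ Submodule.span ℚ (word '' A)) (f : Stuffle L →ₗ[ℚ] M)
    {S : Submodule ℚ M} (h : ∀ w ∈ A, f (word w) ∈ S) : f x ∈ S := by
  have : Submodule.span ℚ (word '' A) ≤ S.comap f := by
    rw [Submodule.span_le]
    rintro _ ⟨w, hw, rfl⟩
    exact h w hw
  exact this hx

/-- The coefficient of the empty word. -/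
def counit : Stuffle L →ₗ[ℚ] ℚ := lift fun w => if w = [] then 1 else 0

@[simp] lemma counit_nil : counit (word ([] : List L)) = 1 := by simp [counit]

@[simp] lemma counit_word_cons (a : L) (w : List L) : counit (word (a :: w)) = 0 := by
  simp [counit]

@[simp] lemma counit_cons (a : L) (x : Stuffle L) : counit (cons a x) = 0 := by
  have h : counit.comp (cons a) = 0 := hom_ext fun w => by simp
  exact congrArg (fun f => f x) h

/-- Concatenation with a letter on the right. -/
def snoc (a : L) : Stuffle L →ₗ[ℚ] Stuffle L := lift fun w => word (w ++ [a])

@[simp] lemma snoc_word (a : L) (w : List L) : snoc a (word w) = word (w ++ [a]) := by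
  simp [snoc]

lemma snoc_cons (a b : L) (x : Stuffle L) : snoc a (cons b x) = cons b (snoc a x) := by
  have h : (snoc a).comp (cons b) = (cons b).comp (snoc a) := hom_ext fun w => by simp
  exact congrArg (fun f => f x) h

lemma shuffle_word (u v : List L) : shuffle (word u) (word v) = shuffleWord u v := by
  simp [shuffle]

lemma shuffle_cons_cons (a b : L) (x y : Stuffle L) :
    shuffle (cons a x) (cons b y)
      = cons a (shuffle x (cons b y)) + cons b (shuffle (cons a x) y) := by
  have h : (shuffle.compl₂ (cons b)).comp (cons a)
      = (shuffle.compl₂ (cons b)).compr₂ (cons a) + (shuffle.comp (cons a)).compr₂ (cons b) := by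
    refine hom_ext fun u => hom_ext fun v => ?_
    simp only [LinearMap.comp_apply, LinearMap.compl₂_apply, LinearMap.add_apply,
      LinearMap.compr₂_apply, cons_word]
    simp [shuffle, shuffleWord]
  exact congrArg (fun f => f x y) h

@[simp] lemma shuffle_nil_left (x : Stuffle L) : shuffle (word []) x = x := by
  have h : shuffle (word ([] : List L)) = LinearMap.id :=
    hom_ext fun v => by simp [shuffle, shuffleWord]
  rw [h]; rfl

@[simp] lemma shuffle_nil_right (x : Stuffle L) : shuffle x (word []) = x := by
  have h : shuffle.flip (word ([] : List L)) = LinearMap.id :=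
    hom_ext fun v => by cases v <;> simp [shuffle, shuffleWord]
  exact congrArg (fun f => f x) h

/-- Induction on pairs of words. -/
lemma word_induction₂ {p : List L → List L → Prop} (nil_left : ∀ v, p [] v)
    (nil_right : ∀ u, p u [])
    (cons_cons : ∀ a u b v, p u (b :: v) → p (a :: u) v → p u v → p (a :: u) (b :: v))
    (u v : List L) : p u v := by
  induction u generalizing v with
  | nil => exact nil_left v
  | cons a u ihu =>
    induction v with
    | nil => exact nil_right _
    | cons b v ihv => exact cons_cons a u b v (ihu _) ihv (ihu _)

section Coproduct

open scoped TensorProduct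

variable [AddCommSemigroup L]

/-! ### The deconcatenation coproduct -/

/-- The sum of `u ⊗ v` over all decompositions of a word into two words `u` and `v`. -/
def deconcatWord : List L → Stuffle L ⊗[ℚ] Stuffle L
  | [] => 1
  | a :: w => 1 ⊗ₜ word (a :: w) + (cons a).rTensor (Stuffle L) (deconcatWord w)

/-- The deconcatenation coproduct as a linear map. -/
def deconcatLin : Stuffle L →ₗ[ℚ] Stuffle L ⊗[ℚ] Stuffle L := lift deconcatWord

lemma deconcatLin_cons (a : L) (x : Stuffle L) : deconcatLin (cons a x)
    = 1 ⊗ₜ cons a x + (cons a).rTensor (Stuffle L) (deconcatLin x) := by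
  have h : deconcatLin.comp (cons a) = (TensorProduct.mk ℚ (Stuffle L) (Stuffle L) 1).comp (cons a)
      + ((cons a).rTensor (Stuffle L)).comp deconcatLin :=
    hom_ext fun w => by simp [deconcatLin, deconcatWord]
  exact congrArg (fun f => f x) h

lemma rTensor_cons_mul (a b : L) (x y : Stuffle L ⊗[ℚ] Stuffle L) :
    (cons a).rTensor (Stuffle L) x * (cons b).rTensor (Stuffle L) y
      = (cons a).rTensor (Stuffle L) (x * (cons b).rTensor (Stuffle L) y)
        + (cons b).rTensor (Stuffle L) ((cons a).rTensor (Stuffle L) x * y)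
        + (cons (a + b)).rTensor (Stuffle L) (x * y) := by
  induction x with
  | zero => simp
  | add x x' hx hx' => simp only [map_add, add_mul, hx, hx']; abel
  | tmul x x' =>
    induction y with
    | zero => simp
    | add y y' hy hy' => simp only [map_add, mul_add, hy, hy']; abel
    | tmul y y' =>
      simp only [LinearMap.rTensor_tmul, Algebra.TensorProduct.tmul_mul_tmul, mul_def,
        stuffle_cons_cons, TensorProduct.add_tmul]

lemma one_tmul_mul_rTensor_cons (a : L) (z : Stuffle L) (x : Stuffle L ⊗[ℚ] Stuffle L) :
    (1 ⊗ₜ z) * (cons a).rTensor (Stuffle L) x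
      = (cons a).rTensor (Stuffle L) ((1 ⊗ₜ z) * x) := by
  induction x with
  | zero => simp
  | add x x' hx hx' => simp only [map_add, mul_add, hx, hx']
  | tmul x x' => simp

/-- Induction along the stuffle recursion. Prefixing a letter in the left tensor factor commutes
with multiplication by `1 ⊗ z`, and two prefixed tensors multiply by the same three-term recursion
as words do. The products of the terms `1 ⊗ au` and `1 ⊗ bv` supply the decompositions with empty
left part. -/
lemma deconcatLin_mul (x y : Stuffle L) :
    deconcatLin (x * y) = deconcatLin x * deconcatLin y := by
  have h : stuffle.compr₂ deconcatLin
      = (LinearMap.mul ℚ (Stuffle L ⊗[ℚ] Stuffle L)).compl₁₂ deconcatLin deconcatLin := by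
    refine hom_ext fun u => hom_ext fun v => ?_
    simp only [LinearMap.compr₂_apply, LinearMap.compl₁₂_apply, LinearMap.mul_apply']
    have h1 : deconcatLin (word ([] : List L)) = 1 := by simp [deconcatLin, deconcatWord]
    refine word_induction₂ (p := fun u v => deconcatLin (stuffle (word u) (word v))
      = deconcatLin (word u) * deconcatLin (word v)) ?_ ?_ ?_ u v
    · intro v; rw [stuffle_nil_left, h1, one_mul]
    · intro u; rw [stuffle_nil_right, h1, mul_one]
    · intro a u b v e1 e2 e3
      simp only [← cons_word] at e1 e2 ⊢
      have e : (1 : Stuffle L) ⊗ₜ[ℚ] stuffle (cons a (word u)) (cons b (word v))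
          = (1 ⊗ₜ cons a (word u)) * (1 ⊗ₜ cons b (word v)) := by
        simp [mul_def]
      have e' : (1 : Stuffle L) ⊗ₜ[ℚ] stuffle (cons a (word u)) (cons b (word v))
          = 1 ⊗ₜ cons a (stuffle (word u) (cons b (word v)))
          + 1 ⊗ₜ cons b (stuffle (cons a (word u)) (word v))
          + 1 ⊗ₜ cons (a + b) (stuffle (word u) (word v)) := by
        rw [stuffle_cons_cons, TensorProduct.tmul_add, TensorProduct.tmul_add]
      rw [stuffle_cons_cons, map_add, map_add, deconcatLin_cons, deconcatLin_cons,
        deconcatLin_cons, e1, e2, e3, deconcatLin_cons a, deconcatLin_cons b, add_mul, add_mul,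
        mul_add, mul_add, mul_add, rTensor_cons_mul, one_tmul_mul_rTensor_cons,
        mul_comm ((cons a).rTensor (Stuffle L) _) (1 ⊗ₜ _), one_tmul_mul_rTensor_cons,
        map_add, map_add, ← e, e', mul_comm (deconcatLin (word u)) (1 ⊗ₜ _)]
      abel
  exact congrArg (fun f => f x y) h

/-- The deconcatenation coproduct. -/
def deconcat : Stuffle L →ₐ[ℚ] Stuffle L ⊗[ℚ] Stuffle L :=
  AlgHom.ofLinearMap deconcatLin (by simp [one_def, deconcatLin, deconcatWord]) deconcatLin_mul

lemma deconcat_word (w : List L) : deconcat (word w)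
    = ∑ i ∈ Finset.range (w.length + 1), word (w.take i) ⊗ₜ word (w.drop i) := by
  change deconcatLin (word w) = _
  rw [deconcatLin, lift_word]
  induction w with
  | nil => simp [deconcatWord, ← one_def, Algebra.TensorProduct.one_def]
  | cons a w ih =>
    rw [deconcatWord, ih, List.length_cons, Finset.sum_range_succ' _ (w.length + 1), map_sum,
      add_comm]
    simp [one_def]

end Coproduct
end Stuffle

namespace FormalMZV

open Stuffle

/-! ### Operators on words in the letters `z_k` -/

lemma exists_succPNat (k : ℕ+) : ∃ n : ℕ, k = n.succPNat := ⟨_, (PNat.succPNat_natPred k).symm⟩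

/-- `z_k w ↦ k z_{k+1} w`. -/
def raise : H1 →ₗ[ℚ] H1 := lift fun
  | [] => 0
  | k :: w => (k : ℚ) • word ((k + 1) :: w)

/-- `z_k w ↦ ∑ z_i z_j w`, the sum over `i + j = k + 1`, and `1 ↦ z_1`. -/
def split : H1 →ₗ[ℚ] H1 := lift fun
  | [] => word [Nat.succPNat 0]
  | k :: w => ∑ p ∈ Finset.HasAntidiagonal.antidiagonal k.natPred,
      word (p.1.succPNat :: p.2.succPNat :: w)

/-- Removal of a letter `x` on the left; the words that do not start in `x` are sent to zero. -/
def lower : H1 →ₗ[ℚ] H1 := lift fun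
  | [] => 0
  | k :: w => match k.natPred with
    | 0 => 0
    | n + 1 => word (n.succPNat :: w)

/-- Removal of a letter `y` on the left; the words that do not start in `y` are sent to zero. -/
def dropOne : H1 →ₗ[ℚ] H1 := lift fun
  | [] => 0
  | k :: w => if k.natPred = 0 then word w else 0

@[simp] lemma raise_nil : raise (word []) = 0 := by simp [raise]

@[simp] lemma raise_word (n : ℕ) (w : List ℕ+) :
    raise (word (n.succPNat :: w)) = ((n : ℚ) + 1) • word ((n + 1).succPNat :: w) := by
  simp only [raise, lift_word]
  congr 1
  simp

@[simp] lemma split_nil : split (word []) = word [Nat.succPNat 0] := by simp [split]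

@[simp] lemma split_word (n : ℕ) (w : List ℕ+) : split (word (n.succPNat :: w))
    = ∑ p ∈ Finset.HasAntidiagonal.antidiagonal n, word (p.1.succPNat :: p.2.succPNat :: w) := by
  simp [split]

@[simp] lemma lower_nil : lower (word []) = 0 := by simp [lower]

@[simp] lemma lower_word_zero (w : List ℕ+) : lower (word ((0 : ℕ).succPNat :: w)) = 0 := by
  simp [lower]

@[simp] lemma lower_word_succ (n : ℕ) (w : List ℕ+) :
    lower (word ((n + 1).succPNat :: w)) = word (n.succPNat :: w) := by
  simp [lower]

@[simp] lemma dropOne_nil : dropOne (word []) = 0 := by simp [dropOne]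

@[simp] lemma dropOne_word_zero (w : List ℕ+) :
    dropOne (word ((0 : ℕ).succPNat :: w)) = word w := by
  simp [dropOne]

@[simp] lemma dropOne_word_succ (n : ℕ) (w : List ℕ+) :
    dropOne (word ((n + 1).succPNat :: w)) = 0 := by
  simp [dropOne]

lemma lower_split (x : H1) : lower (split x) = split (lower x) := by
  have h : lower.comp split = split.comp lower := by
    refine hom_ext fun w => ?_
    match w with
    | [] => simp
    | k :: w =>
      obtain ⟨n, rfl⟩ := exists_succPNat k
      cases n with
      | zero => simp
      | succ n => simp [Finset.Nat.antidiagonal_succ]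
  exact congrArg (fun f => f x) h

/-- If `z_{n+1}` is read as `X^n / n!` in the first variable, `raise` is multiplication by `X` and
`lower` is `d/dX`, so this is the Heisenberg relation. The empty word has no first variable, hence
the hypothesis. -/
lemma lower_raise (x : H1) (hx : counit x = 0) : lower (raise x) = raise (lower x) + x := by
  have h : lower.comp raise = raise.comp lower + LinearMap.id
      - (LinearMap.toSpanSingleton ℚ H1 (word [])).comp counit := by
    refine hom_ext fun w => ?_
    match w with
    | [] => simp
    | k :: w =>
      obtain ⟨n, rfl⟩ := exists_succPNat k
      cases n with
      | zero => simp
      | succ n => simp [add_smul]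
  simpa [hx] using congrArg (fun f => f x) h

/-- In polynomial terms `dropOne` sets the first variable to zero and discards it, while `split`
inserts a new first variable and adds it to the old one. Only the summand starting in `z_1`
survives. -/
lemma dropOne_split (x : H1) : dropOne (split x) = x := by
  have h : dropOne.comp split = LinearMap.id := by
    refine hom_ext fun w => ?_
    match w with
    | [] => simp
    | k :: w =>
      obtain ⟨n, rfl⟩ := exists_succPNat k
      cases n with
      | zero => simp
      | succ n => simp [Finset.Nat.antidiagonal_succ]
  exact congrArg (fun f => f x) h

lemma dropOne_raise (x : H1) : dropOne (raise x) = 0 := by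
  have h : dropOne.comp raise = 0 := by
    refine hom_ext fun w => ?_
    match w with
    | [] => simp
    | k :: w =>
      obtain ⟨n, rfl⟩ := exists_succPNat k
      simp
  exact congrArg (fun f => f x) h

@[simp] lemma counit_raise (x : H1) : counit (raise x) = 0 := by
  have h : counit.comp raise = 0 := by
    refine hom_ext fun w => ?_
    match w with
    | [] => simp
    | k :: w =>
      obtain ⟨n, rfl⟩ := exists_succPNat k
      simp
  exact congrArg (fun f => f x) h

@[simp] lemma counit_split (x : H1) : counit (split x) = 0 := by
  have h : counit.comp split = 0 := by
    refine hom_ext fun w => ?_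
    match w with
    | [] => simp
    | k :: w =>
      obtain ⟨n, rfl⟩ := exists_succPNat k
      simp
  exact congrArg (fun f => f x) h

lemma counit_raise_pow_split (d : ℕ) (x : H1) : counit ((raise ^ d) (split x)) = 0 := by
  cases d with
  | zero => simp
  | succ d => rw [pow_succ', Module.End.mul_apply, counit_raise]

/-- Differentiation in the first variable commutes with `split`, and its commutator with
multiplication by `X^d` is `d X^{d-1}`. For `d = 0` the truncated exponent is harmless, its
coefficient being zero. -/
lemma lower_raise_pow_split (d : ℕ) (x : H1) : lower ((raise ^ d) (split x))
    = (raise ^ d) (split (lower x)) + (d : ℚ) • (raise ^ (d - 1)) (split x) := by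
  induction d with
  | zero => simp [lower_split]
  | succ d ih =>
    rw [pow_succ', Module.End.mul_apply, lower_raise _ (counit_raise_pow_split d x), ih, map_add,
      map_smul, Module.End.mul_apply, add_assoc]
    congr 1
    cases d with
    | zero => simp
    | succ d =>
      simp only [Nat.add_sub_cancel]
      rw [← Module.End.mul_apply, ← pow_succ']
      push_cast
      simp only [add_smul, one_smul]

lemma toXY_succ (n : ℕ) (w : List ℕ+) :
    toXY ((n + 1).succPNat :: w) = XY.x :: toXY (n.succPNat :: w) := by
  simp [toXY, List.replicate_succ]

/-- An element of `𝔥¹`, decomposed by the first letter `x` or `y`. -/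
lemma inclXY_eq (v : H1) : inclXY v = counit v • word [] + cons XY.y (inclXY (dropOne v))
    + cons XY.x (inclXY (lower v)) := by
  have h : inclXY = (LinearMap.toSpanSingleton ℚ (Stuffle XY) (word [])).comp counit
      + (cons XY.y).comp (inclXY.comp dropOne) + (cons XY.x).comp (inclXY.comp lower) := by
    refine hom_ext fun w => ?_
    match w with
    | [] => simp [inclXY, toXY]
    | k :: w =>
      obtain ⟨n, rfl⟩ := exists_succPNat k
      cases n with
      | zero => simp [inclXY]; simp [toXY]
      | succ n => simp [inclXY, toXY_succ]
  exact congrArg (fun f => f v) h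

/-! ### Operators on words in the lower indices -/

/-- The derivative of a word in the lower indices. -/
def derWord : List ℕ → Stuffle ℕ
  | [] => 0
  | d :: u => (d : ℚ) • word ((d - 1) :: u) + cons d (derWord u)

/-- The letterwise derivation `d ↦ d (d - 1)` on words in the lower indices. -/
def der : Stuffle ℕ →ₗ[ℚ] Stuffle ℕ := lift derWord

/-- Removal of a letter `0` on the right; the words that do not end in `0` are sent to zero. -/
def trim : Stuffle ℕ →ₗ[ℚ] Stuffle ℕ :=
  lift fun u => if u.getLast? = some 0 then word u.dropLast else 0

@[simp] lemma der_nil : der (word []) = 0 := by simp [der, derWord]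

lemma der_cons (d : ℕ) (x : Stuffle ℕ) :
    der (cons d x) = (d : ℚ) • cons (d - 1) x + cons d (der x) := by
  have h : der.comp (cons d) = (d : ℚ) • cons (d - 1) + (cons d).comp der :=
    hom_ext fun w => by simp [der, derWord]
  exact congrArg (fun f => f x) h

/-- `derWord` recurses from the left, whereas `theta` grows by appending letters on the right; this
form matches the latter. -/
lemma der_snoc (d : ℕ) (x : Stuffle ℕ) :
    der (snoc d x) = snoc d (der x) + (d : ℚ) • snoc (d - 1) x := by
  have h : der.comp (snoc d) = (snoc d).comp der + (d : ℚ) • snoc (d - 1) := by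
    refine hom_ext fun w => ?_
    induction w with
    | nil =>
      have := der_cons d (word [])
      simpa using this
    | cons e w ih =>
      simp only [LinearMap.comp_apply, LinearMap.add_apply, LinearMap.smul_apply, ← cons_word,
        snoc_cons, der_cons, map_add, map_smul] at ih ⊢
      rw [ih]
      simp only [map_add, map_smul]
      abel
  exact congrArg (fun f => f x) h

@[simp] lemma trim_nil : trim (word []) = 0 := by simp [trim]

lemma trim_word_snoc (d : ℕ) (u : List ℕ) :
    trim (word (u ++ [d])) = if d = 0 then word u else 0 := by
  simp [trim]

/-- The correction appears because a letter put in front of the empty word is also its last letter.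
-/
lemma trim_cons (d : ℕ) (x : Stuffle ℕ) :
    trim (cons d x) = cons d (trim x) + (if d = 0 then counit x else 0) • word [] := by
  have h : trim.comp (cons d) = (cons d).comp trim
      + (LinearMap.toSpanSingleton ℚ (Stuffle ℕ) (word [])).comp
        (if d = 0 then counit else 0) := by
    refine hom_ext fun u => ?_
    rcases List.eq_nil_or_concat u with rfl | ⟨u, e, rfl⟩
    · by_cases hd : d = 0 <;> simp [trim, hd]
    · have : ∀ e, counit (word (u ++ [e])) = 0 := by simp [counit]
      simp only [LinearMap.comp_apply, cons_word, LinearMap.add_apply, List.concat_eq_append,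
        ← List.cons_append, trim_word_snoc]
      by_cases hd : d = 0 <;> by_cases he : e = 0 <;> simp [hd, he, this]
  have := congrArg (fun f => f x) h
  simp only [LinearMap.comp_apply, LinearMap.add_apply] at this
  rw [this]
  by_cases hd : d = 0 <;> simp [hd]

lemma counit_shuffleWord {L : Type} (u v : List L) :
    counit (shuffleWord u v) = counit (word u) * counit (word v) := by
  match u, v with
  | [], v => simp [shuffleWord]
  | a :: u, [] => simp [shuffleWord]
  | a :: u, b :: v => simp [shuffleWord]

/-- A shuffle keeps the letters of both words unchanged, so an operator acting on one letter at a
time obeys the Leibniz rule. -/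
lemma der_shuffle (x y : Stuffle ℕ) :
    der (shuffle x y) = shuffle (der x) y + shuffle x (der y) := by
  have h : shuffle.compr₂ der = shuffle.comp der + shuffle.compl₂ der := by
    refine hom_ext fun u => hom_ext fun v => ?_
    simp only [LinearMap.compr₂_apply, LinearMap.add_apply, LinearMap.comp_apply,
      LinearMap.compl₂_apply]
    refine word_induction₂ (p := fun u v => der (shuffle (word u) (word v))
      = shuffle (der (word u)) (word v) + shuffle (word u) (der (word v))) ?_ ?_ ?_ u v
    · intro v; simp
    · intro u; simp
    · intro a u b v h1 h2 _
      simp only [← cons_word] at h1 h2 ⊢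
      rw [shuffle_cons_cons, map_add, der_cons, der_cons, h1, h2]
      simp only [der_cons, map_add, map_smul, LinearMap.add_apply, LinearMap.smul_apply,
        shuffle_cons_cons, smul_add]
      abel
  exact congrArg (fun f => f x y) h

/-- The last letter of a shuffle is the last letter of one of the two factors. -/
lemma trim_shuffle (x y : Stuffle ℕ) :
    trim (shuffle x y) = shuffle (trim x) y + shuffle x (trim y) := by
  have h : shuffle.compr₂ trim = shuffle.comp trim + shuffle.compl₂ trim := by
    refine hom_ext fun u => hom_ext fun v => ?_
    simp only [LinearMap.compr₂_apply, LinearMap.add_apply, LinearMap.comp_apply,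
      LinearMap.compl₂_apply]
    refine word_induction₂ (p := fun u v => trim (shuffle (word u) (word v))
      = shuffle (trim (word u)) (word v) + shuffle (word u) (trim (word v))) ?_ ?_ ?_ u v
    · intro v; simp
    · intro u; simp
    · intro a u b v h1 h2 _
      -- The corrections in `trim_cons` vanish on this side, because a shuffle with a nonempty
      -- factor has no constant term.
      have c1 : counit (shuffle (word u) (word (b :: v))) = 0 := by
        simp [shuffle_word, counit_shuffleWord]
      have c2 : counit (shuffle (word (a :: u)) (word v)) = 0 := by
        simp [shuffle_word, counit_shuffleWord]
      simp only [← cons_word] at h1 h2 c1 c2 ⊢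
      rw [shuffle_cons_cons, map_add, trim_cons, trim_cons, h1, h2, c1, c2]
      simp only [trim_cons, map_add, map_smul, LinearMap.add_apply, LinearMap.smul_apply,
        shuffle_cons_cons, ite_self, zero_smul, add_zero, shuffle_nil_left,
        shuffle_nil_right]
      abel
  exact congrArg (fun f => f x y) h

/-! ### The swap of a word in the lower indices -/

/-- The words in the `z_k` which are the swaps of the words in the lower indices. -/
def theta : Stuffle ℕ →ₗ[ℚ] H1 :=
  lift fun u => u.foldl (fun v d => (raise ^ d) (split v)) (word [])

@[simp] lemma theta_nil : theta (word []) = word [] := by simp [theta]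

lemma theta_word_snoc (d : ℕ) (u : List ℕ) :
    theta (word (u ++ [d])) = (raise ^ d) (split (theta (word u))) := by
  simp [theta]

lemma theta_snoc (d : ℕ) (x : Stuffle ℕ) :
    theta (snoc d x) = (raise ^ d) (split (theta x)) := by
  have h : theta.comp (snoc d) = (raise ^ d).comp (split.comp theta) :=
    hom_ext fun u => by simp [theta_word_snoc]
  exact congrArg (fun f => f x) h

lemma counit_theta (x : Stuffle ℕ) : counit (theta x) = counit x := by
  have h : counit.comp theta = counit := by
    refine hom_ext fun u => ?_
    rcases List.eq_nil_or_concat u with rfl | ⟨u, d, rfl⟩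
    · simp
    · simp only [LinearMap.comp_apply, List.concat_eq_append, theta_word_snoc,
        counit_raise_pow_split]
      simp [counit]
  exact congrArg (fun f => f x) h

/-- This and `dropOne_theta` translate the removal of the first letter `x` or `y` into `der` and
`trim`. Together with the constant term they determine `theta` recursively. -/
lemma lower_theta (x : Stuffle ℕ) : lower (theta x) = theta (der x) := by
  have h : lower.comp theta = theta.comp der := by
    refine hom_ext fun u => ?_
    induction u using List.reverseRecOn with
    | nil => simp
    | append_singleton u d ih =>
      simp only [LinearMap.comp_apply, ← snoc_word, der_snoc, theta_snoc, map_add, map_smul,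
        lower_raise_pow_split] at ih ⊢
      rw [ih]
  exact congrArg (fun f => f x) h

lemma dropOne_theta (x : Stuffle ℕ) : dropOne (theta x) = theta (trim x) := by
  have h : dropOne.comp theta = theta.comp trim := by
    refine hom_ext fun u => ?_
    rcases List.eq_nil_or_concat u with rfl | ⟨u, d, rfl⟩
    · simp
    · simp only [LinearMap.comp_apply, List.concat_eq_append, theta_word_snoc, trim_word_snoc]
      cases d with
      | zero => simp [dropOne_split]
      | succ d => simp [pow_succ', dropOne_raise]
  exact congrArg (fun f => f x) h

lemma inclXY_theta (x : Stuffle ℕ) : inclXY (theta x) = counit x • word []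
    + cons XY.y (inclXY (theta (trim x))) + cons XY.x (inclXY (theta (der x))) := by
  rw [inclXY_eq, counit_theta, dropOne_theta, lower_theta]

/-- Length plus sum decreases under `der`, as it does under `trim`; this is the measure for the
induction in `inclXY_theta_shuffle`. -/
lemma der_word_mem (u : List ℕ) :
    der (word u) ∈ Submodule.span ℚ (word '' {v | v.length + v.sum < u.length + u.sum}) := by
  induction u with
  | nil => simp
  | cons d u ih =>
    rw [← cons_word, der_cons, cons_word]
    refine Submodule.add_mem _ ?_ ?_
    · rcases Nat.eq_zero_or_pos d with rfl | hd
      · simp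
      · refine Submodule.smul_mem _ _ (Submodule.subset_span ⟨(d - 1) :: u, ?_, rfl⟩)
        simp only [Set.mem_ofPred_eq, List.length_cons, List.sum_cons]
        omega
    · refine map_mem_of_mem_span ih (cons d) fun v hv => ?_
      rw [cons_word]
      refine Submodule.subset_span ⟨d :: v, ?_, rfl⟩
      simp only [Set.mem_ofPred_eq, List.length_cons, List.sum_cons] at hv ⊢
      omega

lemma trim_word_mem (u : List ℕ) :
    trim (word u) ∈ Submodule.span ℚ (word '' {v | v.length + v.sum < u.length + u.sum}) := by
  rcases List.eq_nil_or_concat u with rfl | ⟨u, d, rfl⟩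
  · simp
  · rw [List.concat_eq_append, trim_word_snoc]
    split_ifs
    · refine Submodule.subset_span ⟨u, ?_, rfl⟩
      simp only [Set.mem_ofPred_eq, List.length_append, List.sum_append, List.length_singleton,
        List.sum_singleton]
      omega
    · exact Submodule.zero_mem _

/-- Removing a first letter `x`, or a first letter `y`, is a derivation of the shuffle product of
words in `x` and `y`. Since `der` and `trim` are derivations too, both sides obey the same recursion
on the first letter. -/
lemma inclXY_theta_shuffle (x y : Stuffle ℕ) :
    inclXY (theta (shuffle x y)) = shuffle (inclXY (theta x)) (inclXY (theta y)) := by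
  have key : ∀ (n : ℕ) (u v : List ℕ), u.length + u.sum + (v.length + v.sum) = n →
      inclXY (theta (shuffle (word u) (word v)))
        = shuffle (inclXY (theta (word u))) (inclXY (theta (word v))) := by
    intro n
    induction n using Nat.strong_induction_on with
    | _ n ih =>
      intro u v h
      -- The induction hypothesis is linear in each argument, so it extends from smaller words to
      -- the span that contains `der` and `trim` of a word.
      have hl : ∀ z ∈ Submodule.span ℚ (word '' {w | w.length + w.sum < u.length + u.sum}),
          inclXY (theta (shuffle z (word v)))
            = shuffle (inclXY (theta z)) (inclXY (theta (word v))) := by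
        intro z hz
        refine (Submodule.span_le (p := LinearMap.eqLocus
          (inclXY.comp (theta.comp (shuffle.flip (word v))))
          ((shuffle.flip (inclXY (theta (word v)))).comp (inclXY.comp theta)))).2 ?_ hz
        rintro _ ⟨w, hw, rfl⟩
        simp only [Set.mem_ofPred_eq] at hw
        exact ih _ (by omega) w v rfl
      have hr : ∀ z ∈ Submodule.span ℚ (word '' {w | w.length + w.sum < v.length + v.sum}),
          inclXY (theta (shuffle (word u) z))
            = shuffle (inclXY (theta (word u))) (inclXY (theta z)) := by
        intro z hz
        refine (Submodule.span_le (p := LinearMap.eqLocus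
          (inclXY.comp (theta.comp (shuffle (word u))))
          ((shuffle (inclXY (theta (word u)))).comp (inclXY.comp theta)))).2 ?_ hz
        rintro _ ⟨w, hw, rfl⟩
        simp only [Set.mem_ofPred_eq] at hw
        exact ih _ (by omega) u w rfl
      have e : inclXY (word []) = word [] := by simp [inclXY, toXY]
      match u, v with
      | [], v => simp [e]
      | a :: u, [] => simp [e]
      | a :: u, b :: v =>
        have h1 := hl _ (der_word_mem _)
        have h2 := hl _ (trim_word_mem _)
        have h3 := hr _ (der_word_mem _)
        have h4 := hr _ (trim_word_mem _)
        rw [inclXY_theta (shuffle _ _), der_shuffle, trim_shuffle]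
        simp only [map_add, h1, h2, h3, h4]
        have eu := inclXY_theta (word (a :: u))
        have ev := inclXY_theta (word (b :: v))
        simp only [counit_word_cons, zero_smul, zero_add] at eu ev
        rw [shuffle_word, counit_shuffleWord, counit_word_cons, zero_mul, zero_smul, zero_add]
        rw [eu, ev]
        simp only [map_add, LinearMap.add_apply, shuffle_cons_cons]
        abel
  have h : shuffle.compr₂ (inclXY.comp theta)
      = shuffle.compl₁₂ (inclXY.comp theta) (inclXY.comp theta) :=
    hom_ext fun u => hom_ext fun v => key _ u v rfl
  exact congrArg (fun f => f x y) h

/-- The swap takes the shuffle product of words in the lower indices to the one of `𝔥¹`. -/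
lemma theta_shuffle (x y : Stuffle ℕ) : theta (shuffle x y) = sh (theta x) (theta y) := by
  rw [sh, ← inclXY_theta_shuffle, retractXY_inclXY]

/-- The words of `𝔥¹` are swaps; those that do not start in `y` come from words that do not end
in `0`. -/
lemma word_mem_span_theta (w : List ℕ+) : ∀ m : ℕ, word (m.succPNat :: w) ∈
    Submodule.span ℚ {x | ∃ u d, u.length = w.length ∧ m ≤ d ∧ x = theta (word (u ++ [d]))} := by
  have raise_pow : ∀ (m n : ℕ) (w : List ℕ+), ∃ c : ℚ,
      (raise ^ m) (word (n.succPNat :: w)) = c • word ((n + m).succPNat :: w) ∧ 0 < c := by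
    intro m n w
    induction m with
    | zero => exact ⟨1, by simp, one_pos⟩
    | succ m ih =>
      obtain ⟨c, h, hc⟩ := ih
      refine ⟨c * ((n + m : ℕ) + 1), ?_, by positivity⟩
      rw [pow_succ', Module.End.mul_apply, h, map_smul, raise_word, smul_smul, add_assoc]
  induction w with
  | nil =>
    intro m
    obtain ⟨c, h, hc⟩ := raise_pow m 0 []
    have : word (m.succPNat :: []) = c⁻¹ • theta (word ([] ++ [m])) := by
      rw [theta_word_snoc, theta_nil, split_nil, h, smul_smul, inv_mul_cancel₀ hc.ne', one_smul,
        zero_add]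
    rw [this]
    exact Submodule.smul_mem _ _ (Submodule.subset_span ⟨[], m, rfl, le_rfl, rfl⟩)
  | cons k w ihw =>
    obtain ⟨n, rfl⟩ := exists_succPNat k
    induction n using Nat.strong_induction_on with
    | _ n ihn =>
      intro m
      set S := Submodule.span ℚ {x | ∃ u d, u.length = (n.succPNat :: w).length ∧ m ≤ d ∧
        x = theta (word (u ++ [d]))} with hS
      -- Triangularity: this element expands into a nonzero multiple of the wanted word, from the
      -- summand `(0, n)` of `split`, plus words with a smaller second letter.
      have hmem : (raise ^ m) (split (word (n.succPNat :: w))) ∈ S := by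
        refine (Submodule.span_le (p := S.comap ((raise ^ m).comp split))).2 ?_ (ihw n)
        rintro _ ⟨u, d, hu, -, rfl⟩
        refine Submodule.subset_span ⟨u ++ [d], m, by simp [hu], le_rfl, ?_⟩
        exact (theta_word_snoc m (u ++ [d])).symm
      have hrest : ∀ p ∈ Finset.HasAntidiagonal.antidiagonal n, p ≠ (0, n) →
          (raise ^ m) (word (p.1.succPNat :: p.2.succPNat :: w)) ∈ S := by
        intro p hp hne
        have hp' := Finset.HasAntidiagonal.mem_antidiagonal.1 hp
        obtain ⟨c, h, -⟩ := raise_pow m p.1 (p.2.succPNat :: w)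
        rw [h]
        have hlt : p.2 < n := by
          rcases Nat.eq_zero_or_pos p.1 with h0 | h0
          · exact absurd (Prod.ext h0 (by simp; omega)) hne
          · omega
        -- The second letter has dropped to `p.2 < n`, at the cost of raising the bound `m` to `p.1
        -- + m`, which only strengthens the condition on `d`.
        refine Submodule.smul_mem _ _ (Submodule.span_mono ?_ (ihn p.2 hlt (p.1 + m)))
        rintro _ ⟨u, d, hu, hd, rfl⟩
        exact ⟨u, d, by simpa using hu, by omega, rfl⟩
      obtain ⟨c, h, hc⟩ := raise_pow m 0 (n.succPNat :: w)
      rw [split_word, map_sum, ← Finset.add_sum_erase _ _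
        (Finset.HasAntidiagonal.mem_antidiagonal.2 (zero_add n) : ((0, n) : ℕ × ℕ) ∈ _)] at hmem
      have hsum := Submodule.sum_mem S (t := (Finset.HasAntidiagonal.antidiagonal n).erase (0, n))
        (f := fun p => (raise ^ m) (word (p.1.succPNat :: p.2.succPNat :: w)))
        fun p hp => hrest p (Finset.mem_of_mem_erase hp) (Finset.ne_of_mem_erase hp)
      have := (Submodule.add_mem_iff_left S hsum).1 hmem
      rw [h, zero_add] at this
      exact (Submodule.smul_mem_iff _ hc.ne').1 this

lemma word_mem_span_theta_length (w : List ℕ+) : word w ∈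
    Submodule.span ℚ {x | ∃ u : List ℕ, u.length = w.length ∧ x = theta (word u)} := by
  cases w with
  | nil => exact Submodule.subset_span ⟨[], rfl, by simp⟩
  | cons k w =>
    obtain ⟨n, rfl⟩ := exists_succPNat k
    refine Submodule.span_mono ?_ (word_mem_span_theta w n)
    rintro _ ⟨u, d, hu, -, rfl⟩
    exact ⟨u ++ [d], by simp [hu], rfl⟩

lemma raise_mem_span_length {r : ℕ} {x : H1}
    (hx : x ∈ Submodule.span ℚ (word '' {w : List ℕ+ | w.length = r})) :
    raise x ∈ Submodule.span ℚ (word '' {w : List ℕ+ | w.length = r}) := by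
  refine map_mem_of_mem_span hx raise fun w hw => ?_
  cases w with
  | nil => simp
  | cons k w =>
    obtain ⟨n, rfl⟩ := exists_succPNat k
    rw [raise_word]
    exact Submodule.smul_mem _ _ (Submodule.subset_span ⟨_, by simpa using hw, rfl⟩)

lemma theta_word_mem_span_length (u : List ℕ) :
    theta (word u) ∈ Submodule.span ℚ (word '' {w : List ℕ+ | w.length = u.length}) := by
  induction u using List.reverseRecOn with
  | nil => exact Submodule.subset_span ⟨[], rfl, by simp⟩
  | append_singleton u d ih =>
    rw [theta_word_snoc]
    induction d with
    | succ d ihd => rw [pow_succ']; simpa using raise_mem_span_length ihd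
    | zero =>
      refine map_mem_of_mem_span ih split fun w hw => ?_
      cases w with
      | nil =>
        rw [split_nil]
        exact Submodule.subset_span ⟨_, by simpa [eq_comm] using hw, rfl⟩
      | cons k w =>
        obtain ⟨n, rfl⟩ := exists_succPNat k
        rw [split_word]
        exact Submodule.sum_mem _ fun p _ => Submodule.subset_span ⟨_, by simpa using hw, rfl⟩

/-! ### The swap computed on polynomials. -/

section Polynomials

open MvPolynomial

/-! ### Linear substitutions and their transposes -/

section Transpose

variable {S : Type} [Fintype S] [DecidableEq S]

/-- The linear form with the coefficients of a row. -/
def rowForm (s : S → S → ℚ) (j : S) : MvPolynomial S ℚ := ∑ i, C (s j i) * X i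

lemma pderiv_aeval_rowForm (s : S → S → ℚ) (i : S) (f : MvPolynomial S ℚ) :
    pderiv i (aeval (rowForm s) f) = ∑ j, C (s j i) * aeval (rowForm s) (pderiv j f) := by
  induction f using MvPolynomial.induction_on with
  | C a => simp [algebraMap_eq]
  | add p q hp hq => simp only [map_add, hp, hq, mul_add, Finset.sum_add_distrib]
  | mul_X p k hp =>
    have h : pderiv i (rowForm s k) = C (s k i) := by
      simp [rowForm, Derivation.leibniz, pderiv_X, Pi.single_apply]
    simp only [map_mul, aeval_X, Derivation.leibniz, hp, h, pderiv_X, smul_eq_mul, map_add,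
      mul_add, Finset.sum_add_distrib, Finset.mul_sum]
    congr 1
    · rw [Finset.sum_eq_single k]
      · simp [mul_comm]
      · intro j _ hj; simp [hj]
      · simp
    · exact Finset.sum_congr rfl fun j _ => by ring

/-- For the pairing under which `X^m` and `X^d` are orthogonal and `X^m` has norm `m!`,
multiplication by a variable is adjoint to its partial derivative. Hence a linear substitution is
adjoint to the transposed one. The induction peels one variable off `m` and applies the chain rule
to the other side. -/
lemma coeff_aeval_rowForm_transpose (s : S → S → ℚ) (m d : S →₀ ℕ) :
    (∏ i, ((m i).factorial : ℚ)) * coeff m (aeval (rowForm s) (monomial d (1 : ℚ)))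
      = (∏ i, ((d i).factorial : ℚ))
        * coeff d (aeval (rowForm fun i j => s j i) (monomial m (1 : ℚ))) := by
  induction hn : m.degree generalizing m d with
  | zero =>
    obtain rfl : m = 0 := (Finsupp.degree_eq_zero_iff m).1 hn
    have h0 : ∀ j, constantCoeff (rowForm s j) = 0 := by simp [rowForm]
    have h1 : coeff 0 (aeval (rowForm s) (monomial d (1 : ℚ))) = if d = 0 then (1 : ℚ) else 0 := by
      change constantCoeff _ = _
      split_ifs with h
      · simp [h]
      · rw [aeval_monomial, map_mul, Finsupp.prod, map_prod]
        obtain ⟨k, hk⟩ := Finsupp.ne_iff.1 h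
        rw [Finset.prod_eq_zero (Finsupp.mem_support_iff.2 hk), mul_zero]
        rw [map_pow, h0, zero_pow hk]
    have h2 : coeff d (aeval (rowForm fun i j => s j i) (monomial 0 (1 : ℚ)))
        = if d = 0 then (1 : ℚ) else 0 := by
      have : (monomial (0 : S →₀ ℕ) (1 : ℚ) : MvPolynomial S ℚ) = 1 := rfl
      rw [this, map_one, coeff_one]
      simp [eq_comm]
    rw [h1, h2]
    split_ifs with h
    · simp [h]
    · simp
  | succ n ih =>
    have hm : m ≠ 0 := by rintro rfl; simp at hn
    obtain ⟨i, hi⟩ := Finsupp.ne_iff.1 hm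
    obtain ⟨m, rfl⟩ : ∃ m', m = m' + Finsupp.single i 1 := by
      refine ⟨m - Finsupp.single i 1, (tsub_add_cancel_of_le ?_).symm⟩
      simpa [Nat.one_le_iff_ne_zero] using hi
    have hdeg : m.degree = n := by simpa using hn
    have hfac : ∀ (m : S →₀ ℕ) (i : S), (∏ k, (((m + Finsupp.single i 1 : S →₀ ℕ) k).factorial : ℚ))
        = ((m i : ℚ) + 1) * ∏ k, ((m k).factorial : ℚ) := by
      intro m i
      rw [← Finset.mul_prod_erase _ _ (Finset.mem_univ i),
        ← Finset.mul_prod_erase _ (fun k => ((m k).factorial : ℚ)) (Finset.mem_univ i), ← mul_assoc]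
      congr 1
      · simp [Nat.factorial_succ]
      · refine Finset.prod_congr rfl fun k hk => ?_
        simp [Ne.symm (Finset.ne_of_mem_erase hk)]
    have hX : (monomial (m + Finsupp.single i 1) (1 : ℚ)) = X i * monomial m 1 := by
      rw [X, monomial_mul, one_mul, add_comm]
    rw [hfac, mul_right_comm, mul_comm (_ + 1), ← coeff_pderiv, pderiv_aeval_rowForm, coeff_sum,
      Finset.sum_mul, hX, map_mul, aeval_X]
    have hrow : rowForm (fun i j => s j i) i = ∑ j, C (s j i) * X j := rfl
    rw [hrow, Finset.sum_mul, coeff_sum, Finset.mul_sum]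
    refine Finset.sum_congr rfl fun j _ => ?_
    rw [coeff_C_mul, mul_assoc (C _), coeff_C_mul, coeff_X_mul', pderiv_monomial]
    by_cases hj : d j = 0
    · have : j ∉ d.support := by simpa using hj
      simp [hj, this]
    · obtain ⟨d, rfl⟩ : ∃ d', d = d' + Finsupp.single j 1 := by
        refine ⟨d - Finsupp.single j 1, (tsub_add_cancel_of_le ?_).symm⟩
        simpa [Nat.one_le_iff_ne_zero] using hj
      have hmem : j ∈ (d + Finsupp.single j 1).support := by simp
      rw [if_pos hmem, add_tsub_cancel_right, hfac]
      have hC : (monomial d (1 * (((d + Finsupp.single j 1 : S →₀ ℕ) j : ℕ) : ℚ)))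
          = C ((d j : ℚ) + 1) * monomial d 1 := by
        rw [C_mul_monomial]; simp
      rw [hC, map_mul, aeval_C, algebraMap_eq, coeff_C_mul]
      linear_combination (s j i * ((d j : ℚ) + 1)) * ih m d hdeg

end Transpose

/-! ### Words of a fixed length as monomials -/

/-- The monomial `∏ X_j ^ (k_j - 1)` is `∏ (k_j - 1)!` times the word with letters `z_{k_j}`. -/
def ofPoly (r : ℕ) : MvPolynomial (Fin r) ℚ →ₗ[ℚ] H1 :=
  (basisMonomials (Fin r) ℚ).constr ℚ fun m =>
    (∏ j, ((m j).factorial : ℚ)) • word (List.ofFn fun j => (m j).succPNat)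

lemma ofPoly_monomial (r : ℕ) (m : Fin r →₀ ℕ) : ofPoly r (monomial m 1)
    = (∏ j, ((m j).factorial : ℚ)) • word (List.ofFn fun j => (m j).succPNat) := by
  have := (basisMonomials (Fin r) ℚ).constr_basis ℚ (fun m =>
    (∏ j, ((m j).factorial : ℚ)) • word (List.ofFn fun j => (m j).succPNat)) m
  rwa [coe_basisMonomials] at this

lemma monomial_equivFunOnFinite {S : Type} [Fintype S] (a : S → ℕ) :
    (monomial (Finsupp.equivFunOnFinite.symm a) (1 : ℚ)) = ∏ j, X j ^ a j := by
  rw [monomial_eq, Finsupp.prod_fintype _ _ (by simp)]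
  simp

lemma ofPoly_prod (r : ℕ) (a : Fin r → ℕ) : ofPoly r (∏ j, X j ^ a j)
    = (∏ j, ((a j).factorial : ℚ)) • word (List.ofFn fun j => (a j).succPNat) := by
  rw [← monomial_equivFunOnFinite, ofPoly_monomial]
  simp

lemma linearMap_ext_prod {S M : Type} [Fintype S] [AddCommGroup M] [Module ℚ M]
    {f g : MvPolynomial S ℚ →ₗ[ℚ] M} (h : ∀ a : S → ℕ, f (∏ j, X j ^ a j) = g (∏ j, X j ^ a j)) :
    f = g := by
  refine (basisMonomials S ℚ).ext fun m => ?_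
  have := h m
  rw [← monomial_equivFunOnFinite] at this
  simpa using this

/-- The factor `k` in `raise` is the quotient of the factorials in the normalization of `ofPoly`. -/
lemma raise_ofPoly (r : ℕ) (f : MvPolynomial (Fin (r + 1)) ℚ) :
    raise (ofPoly (r + 1) f) = ofPoly (r + 1) (X 0 * f) := by
  have h : raise.comp (ofPoly (r + 1))
      = (ofPoly (r + 1)).comp (LinearMap.mulLeft ℚ (X 0)) := by
    refine linearMap_ext_prod fun a => ?_
    have : X 0 * ∏ j, X j ^ a j
        = ∏ j, (X j : MvPolynomial (Fin (r + 1)) ℚ) ^ (Fin.cons (a 0 + 1) (Fin.tail a)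
          : Fin (r + 1) → ℕ) j := by
      simp [Fin.prod_univ_succ, pow_succ', mul_assoc, Fin.tail]
    rw [LinearMap.comp_apply, LinearMap.comp_apply, LinearMap.mulLeft_apply, this, ofPoly_prod,
      ofPoly_prod, map_smul]
    simp only [List.ofFn_succ, raise_word, Fin.prod_univ_succ, Fin.cons_zero, Fin.cons_succ,
      Fin.tail, smul_smul, Nat.factorial_succ]
    congr 1
    push_cast
    ring
  exact congrArg (fun g => g f) h

/-- The substitution `X_1 ↦ X_1 + X_2`, `X_j ↦ X_{j+1}` for `j > 1`. -/
def splitVar (r : ℕ) : MvPolynomial (Fin r) ℚ →ₐ[ℚ] MvPolynomial (Fin (r + 1)) ℚ :=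
  aeval fun j => if (j : ℕ) = 0 then X 0 + X j.succ else X j.succ

/-- The binomial coefficients of `(X_1 + X_2)^n` cancel against the factorials of `ofPoly`, leaving
the sum over all splittings with coefficient `1`. -/
lemma split_ofPoly (r : ℕ) (f : MvPolynomial (Fin r) ℚ) :
    split (ofPoly r f) = ofPoly (r + 1) (splitVar r f) := by
  have h : split.comp (ofPoly r) = (ofPoly (r + 1)).comp (splitVar r).toLinearMap := by
    refine linearMap_ext_prod fun a => ?_
    simp only [LinearMap.comp_apply, AlgHom.toLinearMap_apply, ofPoly_prod, map_prod, map_pow,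
      map_smul]
    cases r with
    | zero =>
      have := ofPoly_prod 1 fun _ => 0
      simp only [pow_zero, Finset.prod_const_one] at this
      simp [this]
    | succ r =>
      have hprod : ∀ p : ℕ × ℕ, (X 0 ^ p.1 * X 1 ^ p.2 : MvPolynomial (Fin (r + 2)) ℚ)
          * ∏ j : Fin r, X j.succ.succ ^ a j.succ
          = ∏ j, X j ^ (Fin.cons p.1 (Fin.cons p.2 (Fin.tail a)) : Fin (r + 2) → ℕ) j := by
        intro p
        simp [Fin.prod_univ_succ, mul_assoc, Fin.tail]
      rw [Fin.prod_univ_succ (n := r) (f := fun j => splitVar (r + 1) (X j) ^ a j)]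
      simp only [splitVar, aeval_X, Fin.val_zero, if_true, Fin.val_succ, Nat.succ_ne_zero,
        if_false, Fin.succ_zero_eq_one]
      rw [(Commute.all _ _).add_pow', Finset.sum_mul, map_sum, List.ofFn_succ, split_word,
        Finset.smul_sum]
      refine Finset.sum_congr rfl fun p hp => ?_
      rw [smul_mul_assoc, hprod, map_nsmul, ofPoly_prod, ← Nat.cast_smul_eq_nsmul ℚ, smul_smul]
      simp only [List.ofFn_succ, Fin.prod_univ_succ, Fin.cons_zero, Fin.cons_succ, Fin.tail]
      congr 1
      have := Nat.add_choose_mul_factorial_mul_factorial p.2 p.1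
      rw [add_comm p.2, Finset.HasAntidiagonal.mem_antidiagonal.1 hp] at this
      rw [← this]
      push_cast
      ring
  exact congrArg (fun g => g f) h

lemma sum_Iic_succ {M : Type} [AddCommMonoid M] {r : ℕ} (k : Fin r) (f : Fin (r + 1) → M) :
    ∑ j ∈ Finset.Iic k.succ, f j = f 0 + ∑ j ∈ Finset.Iic k, f j.succ := by
  have h : ∀ {n : ℕ} (k : Fin n) (f : Fin n → M),
      ∑ j ∈ Finset.Iic k, f j = ∑ j, if j ≤ k then f j else 0 := by
    intro n k f
    rw [← Finset.sum_filter]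
    congr 1
    ext; simp
  rw [h, h, Fin.sum_univ_succ]
  simp

/-- The product of the powers of the partial sums of the variables which stands for the swap of a
word in the lower indices. -/
def sumPoly {r : ℕ} (u : Fin r → ℕ) : MvPolynomial (Fin r) ℚ :=
  ∏ i, (∑ j ∈ Finset.Iic i.rev, X j) ^ u i

/-- Every initial sum contains the old first variable exactly once, so the new one is added exactly
once. -/
lemma splitVar_sum {r : ℕ} (k : Fin r) : splitVar r (∑ j ∈ Finset.Iic k, X j)
    = ∑ j ∈ Finset.Iic k.succ, X j := by
  obtain ⟨r, rfl⟩ : ∃ n, r = n + 1 := ⟨r - 1, by have := k.pos; omega⟩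
  have : ∀ j : Fin (r + 1), splitVar (r + 1) (X j)
      = (if j = 0 then X 0 else 0) + X j.succ := by
    intro j
    rw [splitVar, aeval_X]
    by_cases hj : j = 0 <;> simp [hj]
  rw [sum_Iic_succ, map_sum, Finset.sum_congr rfl fun j _ => this j, Finset.sum_add_distrib,
    Finset.sum_ite_eq']
  simp

lemma theta_ofFn {r : ℕ} (u : Fin r → ℕ) :
    theta (word (List.ofFn u)) = ofPoly r (sumPoly u) := by
  induction r with
  | zero =>
    have := ofPoly_prod 0 fun _ => 0
    simp only [Finset.univ_eq_empty, Finset.prod_empty] at this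
    simp [sumPoly, this]
  | succ r ih =>
    have hpow : ∀ (d : ℕ) (f : MvPolynomial (Fin (r + 1)) ℚ),
        (raise ^ d) (ofPoly (r + 1) f) = ofPoly (r + 1) (X 0 ^ d * f) := by
      intro d f
      induction d with
      | zero => simp
      | succ d ihd => rw [pow_succ', Module.End.mul_apply, ihd, raise_ofPoly, pow_succ', mul_assoc]
    -- The last letter is applied last, so its factor is a power of the first variable alone; all
    -- earlier factors pass through one more `splitVar`.
    rw [List.ofFn_succ', List.concat_eq_append, theta_word_snoc, ih, split_ofPoly, hpow]
    congr 1
    rw [sumPoly, sumPoly, Fin.prod_univ_castSucc, mul_comm, map_prod]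
    congr 1
    · refine Finset.prod_congr rfl fun i _ => ?_
      rw [map_pow, splitVar_sum, Fin.rev_castSucc]
    · have : Finset.Iic (0 : Fin (r + 1)) = {0} := by ext; simp
      rw [Fin.rev_last, this, Finset.sum_singleton]

/-! ### The swap as a linear change of variables -/

/-- The matrix of the change of variables of the swap. -/
def swapMatrix (r : ℕ) : Fin r ⊕ Fin r → Fin r ⊕ Fin r → ℚ
  | Sum.inl j, Sum.inr i => if i ≤ j.rev then 1 else 0
  | Sum.inr j, Sum.inl i =>
      (if i = j.rev then 1 else 0) - (if (i : ℕ) = (j.rev : ℕ) + 1 then 1 else 0)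
  | _, _ => 0

/-- The word with the exponents of a monomial. -/
def letters {r : ℕ} (m : Fin r ⊕ Fin r → ℕ) : List Letter :=
  List.ofFn fun j => ((m (Sum.inl j)).succPNat, m (Sum.inr j))

/-- The monomial `∏ X_j ^ (k_j - 1) Y_j ^ d_j` is `∏ (k_j - 1)!` times the word with letters
`(k_j, d_j)`. -/
def ofBiPoly (r : ℕ) : MvPolynomial (Fin r ⊕ Fin r) ℚ →ₗ[ℚ] QA :=
  (basisMonomials (Fin r ⊕ Fin r) ℚ).constr ℚ fun m =>
    (∏ j, ((m (Sum.inl j)).factorial : ℚ)) • word (letters m)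

lemma ofBiPoly_monomial (r : ℕ) (m : Fin r ⊕ Fin r →₀ ℕ) : ofBiPoly r (monomial m 1)
    = (∏ j, ((m (Sum.inl j)).factorial : ℚ)) • word (letters m) := by
  have := (basisMonomials (Fin r ⊕ Fin r) ℚ).constr_basis ℚ (fun m =>
    (∏ j, ((m (Sum.inl j)).factorial : ℚ)) • word (letters m)) m
  rwa [coe_basisMonomials] at this

lemma ofBiPoly_eq_sum (r : ℕ) (f : MvPolynomial (Fin r ⊕ Fin r) ℚ) : ofBiPoly r f
    = ∑ d ∈ f.support, coeff d f • (∏ j, ((d (Sum.inl j)).factorial : ℚ)) • word (letters d) := by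
  conv_lhs => rw [f.as_sum, map_sum]
  refine Finset.sum_congr rfl fun d _ => ?_
  rw [← ofBiPoly_monomial, ← map_smul, smul_monomial, smul_eq_mul, mul_one]

lemma swap_word_letters {r : ℕ} (m : Fin r ⊕ Fin r →₀ ℕ) : swap (word (letters m))
    = (∏ j, ((m (Sum.inr j)).factorial : ℚ)) •
      MvPowerSeries.coeff m (swapSeries (genSeries r)) := by
  -- The type of `exponent w` depends on the length of `w`; making that length a variable lets it be
  -- eliminated.
  have key : ∀ (w : List Letter) (r : ℕ) (h : w.length = r) (m : Fin r ⊕ Fin r →₀ ℕ),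
      (∀ j : Fin r, w.get (j.cast h.symm) = ((m (Sum.inl j)).succPNat, m (Sum.inr j))) →
      swap (word w) = (∏ j, ((m (Sum.inr j)).factorial : ℚ)) •
        MvPowerSeries.coeff m (swapSeries (genSeries r)) := by
    rintro w r rfl m hm
    have hm' : ∀ j, w.get j = ((m (Sum.inl j)).succPNat, m (Sum.inr j)) := hm
    have he : exponent w = m := by
      ext s
      rcases s with j | j <;> simp only [exponent, Finsupp.coe_equivFunOnFinite_symm,
        Sum.elim_inl, Sum.elim_inr, hm', Nat.natPred_succPNat]
    rw [swap, lift_word, he]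
    simp only [hm']
  refine key _ r (by simp [letters]) m fun j => ?_
  simp only [letters, List.get_ofFn]
  rfl

lemma swapVar_eq (r : ℕ) (s : Fin r ⊕ Fin r) : swapVar QA r s
    = MvPowerSeries.map (algebraMap ℚ QA)
      (rowForm (swapMatrix r) s : MvPowerSeries (Fin r ⊕ Fin r) ℚ) := by
  have h : ∀ s, (rowForm (swapMatrix r) s : MvPowerSeries (Fin r ⊕ Fin r) ℚ)
      = ∑ i, MvPowerSeries.C (swapMatrix r s i) * MvPowerSeries.X i := by
    intro s
    rw [rowForm, ← coeToMvPowerSeries.ringHom_apply, map_sum]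
    simp
  rw [h, map_sum]
  simp only [map_mul, MvPowerSeries.map_C, MvPowerSeries.map_X, Fintype.sum_sum_type]
  rcases s with j | j
  · simp only [swapMatrix, swapVar, Sum.elim_inl, map_zero, zero_mul, Finset.sum_const_zero,
      zero_add]
    have : Finset.Iic j.rev = Finset.univ.filter fun i => i ≤ j.rev := by ext; simp
    rw [this, Finset.sum_filter]
    refine Finset.sum_congr rfl fun i _ => ?_
    split_ifs <;> simp
  · simp only [swapMatrix, swapVar, Sum.elim_inr, map_zero, zero_mul, Finset.sum_const_zero,
      add_zero, map_sub, sub_mul, Finset.sum_sub_distrib]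
    congr 1
    · rw [Finset.sum_eq_single j.rev]
      · simp
      · intro i _ hi; simp [hi]
      · simp
    · split_ifs with h
      · rw [Finset.sum_eq_single ⟨j.rev.val + 1, h⟩]
        · simp
        · intro i _ hi
          rw [if_neg fun h' => hi (Fin.ext h')]
          simp
        · simp
      · refine (Finset.sum_eq_zero fun i _ => ?_).symm
        have hi : (i : ℕ) ≠ (j.rev : ℕ) + 1 := fun h' => h (by rw [← h']; exact i.2)
        rw [if_neg hi]
        simp

lemma coeff_swapVar_prod (r : ℕ) (m d : Fin r ⊕ Fin r →₀ ℕ) :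
    MvPowerSeries.coeff m (d.prod fun s e => swapVar QA r s ^ e)
      = algebraMap ℚ QA (coeff m (aeval (rowForm (swapMatrix r)) (monomial d (1 : ℚ)))) := by
  have h : (d.prod fun s e => swapVar QA r s ^ e) = MvPowerSeries.map (algebraMap ℚ QA)
      (coeToMvPowerSeries.ringHom (aeval (rowForm (swapMatrix r)) (monomial d (1 : ℚ)))) := by
    rw [aeval_monomial, map_one, one_mul, map_finsuppProd, map_finsuppProd]
    refine Finsupp.prod_congr fun s _ => ?_
    rw [map_pow, map_pow, coeToMvPowerSeries.ringHom_apply, swapVar_eq]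
  rw [h, MvPowerSeries.coeff_map, coeToMvPowerSeries.ringHom_apply, coeff_coe]

/-- The swap is the transpose of its change of variables. -/
lemma swap_ofBiPoly (r : ℕ) (f : MvPolynomial (Fin r ⊕ Fin r) ℚ) : swap (ofBiPoly r f)
    = ofBiPoly r (aeval (rowForm fun i j => swapMatrix r j i) f) := by
  have h : swap.comp (ofBiPoly r) = (ofBiPoly r).comp
      (aeval (rowForm fun i j => swapMatrix r j i)).toLinearMap := by
    refine (basisMonomials (Fin r ⊕ Fin r) ℚ).ext fun m => ?_
    rw [coe_basisMonomials]
    simp only [LinearMap.comp_apply, AlgHom.toLinearMap_apply]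
    set f := aeval (rowForm fun i j => swapMatrix r j i) (monomial m (1 : ℚ)) with hf
    have hfac : ∀ m : Fin r ⊕ Fin r →₀ ℕ, (∏ s, ((m s).factorial : ℚ))
        = (∏ j, ((m (Sum.inl j)).factorial : ℚ)) * ∏ j, ((m (Sum.inr j)).factorial : ℚ) :=
      fun m => Fintype.prod_sum_type _
    have hne : ∀ (m : Fin r ⊕ Fin r →₀ ℕ) (g : Fin r → Fin r ⊕ Fin r),
        (∏ j, ((m (g j)).factorial : ℚ)) ≠ 0 := fun m g =>
      Finset.prod_ne_zero_iff.2 fun j _ => Nat.cast_ne_zero.2 (Nat.factorial_ne_zero _)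
    -- The generating series contributes the inverse factorials of the lower exponents of `d`, and
    -- transposition contributes all factorials of `d`; those of the upper exponents remain, as
    -- `ofBiPoly` requires.
    have hterm : ∀ d : Fin r ⊕ Fin r →₀ ℕ, MvPowerSeries.coeff d (genSeries r) •
        MvPowerSeries.coeff m (d.prod fun s e => swapVar QA r s ^ e)
        = (∏ s, ((m s).factorial : ℚ))⁻¹ • coeff d f •
          (∏ j, ((d (Sum.inl j)).factorial : ℚ)) • word (letters d) := by
      intro d
      have htr := coeff_aeval_rowForm_transpose (swapMatrix r) m d
      rw [← hf, hfac, hfac d] at htr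
      rw [coeff_swapVar_prod, coeff_genSeries, smul_eq_mul, mul_comm, ← Algebra.smul_def,
        smul_smul, smul_smul, smul_smul, letters, hfac]
      congr 1
      field_simp [hne]
      linear_combination htr
    have hsum : MvPowerSeries.coeff m (swapSeries (genSeries r))
        = (∏ s, ((m s).factorial : ℚ))⁻¹ • ofBiPoly r f := by
      rw [swapSeries, MvPowerSeries.coeff_subst (hasSubst_swapVar QA r),
        finsum_congr hterm, ofBiPoly_eq_sum, Finset.smul_sum]
      -- The coefficient formula sums over all exponents, but only the monomials of the substituted
      -- polynomial contribute.
      refine finsum_eq_sum_of_support_subset _ fun d hd => ?_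
      simp only [Function.mem_support, ne_eq] at hd
      simp only [Finset.mem_coe, mem_support_iff]
      intro h0
      exact hd (by rw [h0, zero_smul, smul_zero])
    rw [ofBiPoly_monomial, map_smul, swap_word_letters, hsum, smul_smul, smul_smul, ← hfac,
      mul_inv_cancel₀ (hfac m ▸ mul_ne_zero (hne m _) (hne m _)), one_smul]
  exact congrArg (fun g => g f) h

/-- The word with upper indices `k_j` and lower indices `d_j`. -/
def zipWord (u : List ℕ) : H1 →ₗ[ℚ] QA := lift fun k => word (k.zip u)

lemma zipWord_ofPoly {r : ℕ} (u : Fin r → ℕ) (f : MvPolynomial (Fin r) ℚ) :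
    zipWord (List.ofFn u) (ofPoly r f)
      = ofBiPoly r (rename Sum.inl f * ∏ j, X (Sum.inr j) ^ u j) := by
  have h : (zipWord (List.ofFn u)).comp (ofPoly r) = (ofBiPoly r).comp
      ((LinearMap.mulRight ℚ (∏ j, X (Sum.inr j) ^ u j)).comp
        (rename Sum.inl).toLinearMap) := by
    refine linearMap_ext_prod fun a => ?_
    simp only [LinearMap.comp_apply, AlgHom.toLinearMap_apply, LinearMap.mulRight_apply,
      ofPoly_prod, map_prod, map_pow, rename_X]
    have hp : ((∏ j, X (Sum.inl j) ^ a j) * ∏ j, X (Sum.inr j) ^ u j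
        : MvPolynomial (Fin r ⊕ Fin r) ℚ)
        = monomial (Finsupp.equivFunOnFinite.symm (Sum.elim a u)) 1 := by
      rw [monomial_equivFunOnFinite, Fintype.prod_sum_type]
      rfl
    rw [hp, ofBiPoly_monomial, map_smul, zipWord, lift_word]
    congr 2
    refine List.ext_getElem (by simp [letters]) fun i h1 h2 => ?_
    simp [letters]
  exact congrArg (fun g => g f) h

/-- The swap exchanges the upper and the lower indices. -/
lemma swap_zipWord_theta {u v : List ℕ} (h : u.length = v.length) :
    swap (zipWord u (theta (word v))) = zipWord v (theta (word u)) := by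
  obtain ⟨r, hu⟩ : ∃ r, u.length = r := ⟨_, rfl⟩
  obtain ⟨u, rfl⟩ : ∃ f : Fin r → ℕ, u = List.ofFn f :=
    ⟨fun j => u.get (j.cast hu.symm), by subst hu; simp⟩
  have hv : v.length = r := by rw [← h, hu]
  obtain ⟨v, rfl⟩ : ∃ f : Fin r → ℕ, v = List.ofFn f :=
    ⟨fun j => v.get (j.cast hv.symm), by subst hv; simp⟩
  rw [theta_ofFn, theta_ofFn, zipWord_ofPoly, zipWord_ofPoly, swap_ofBiPoly]
  congr 1
  -- The transposed substitution interchanges the factors: powers of the `Y_i` become those of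
  -- partial sums of the `X_j` (`hY`), and partial sums of the `X_j` telescope to single `Y_i`
  -- (`hX`).
  rw [map_mul, mul_comm]
  have hY : ∀ i : Fin r, rowForm (fun i j => swapMatrix r j i) (Sum.inr i)
      = rename Sum.inl (∑ j ∈ Finset.Iic i.rev, X j) := by
    intro i
    have : Finset.Iic i.rev = Finset.univ.filter fun j => j ≤ i.rev := by ext; simp
    rw [rowForm, Fintype.sum_sum_type, this, Finset.sum_filter, map_sum]
    simp only [swapMatrix, map_zero, zero_mul, Finset.sum_const_zero, add_zero]
    refine Finset.sum_congr rfl fun j _ => ?_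
    simp only [Fin.le_rev_iff (i := i)]
    split_ifs <;> simp
  have hX : ∀ i : Fin r, ∑ j ∈ Finset.Iic i.rev, rowForm (fun i j => swapMatrix r j i) (Sum.inl j)
      = X (Sum.inr i) := by
    intro i
    simp only [rowForm]
    rw [Finset.sum_comm, Fintype.sum_sum_type]
    simp only [swapMatrix, map_zero, zero_mul, Finset.sum_const_zero, zero_add, ← Finset.sum_mul,
      ← map_sum]
    have hsum : ∀ k : Fin r, ∑ j ∈ Finset.Iic i.rev, ((if j = k.rev then (1 : ℚ) else 0)
        - if (j : ℕ) = (k.rev : ℕ) + 1 then 1 else 0) = if k = i then 1 else 0 := by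
      intro k
      rw [Finset.sum_sub_distrib, Finset.sum_ite_eq']
      -- The two indicator sums differ only in `≤` versus `<`, so their difference is the indicator
      -- of `k = i`.
      have h2 : (∑ j ∈ Finset.Iic i.rev, if (j : ℕ) = (k.rev : ℕ) + 1 then (1 : ℚ) else 0)
          = if k.rev < i.rev then 1 else 0 := by
        split_ifs with hk
        · have hk' : (k.rev : ℕ) + 1 < r := by have := i.rev.2; have := Fin.lt_def.1 hk; omega
          rw [Finset.sum_eq_single ⟨k.rev + 1, hk'⟩]
          · simp
          · intro j _ hj
            exact if_neg fun h' => hj (Fin.ext h')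
          · intro hn
            exact absurd (Finset.mem_Iic.2 (Fin.le_def.2 (by simpa using Fin.lt_def.1 hk))) hn
        · refine Finset.sum_eq_zero fun j hj => if_neg fun h' => hk ?_
          have := Fin.le_def.1 (Finset.mem_Iic.1 hj)
          exact Fin.lt_def.2 (by omega)
      rw [h2]
      by_cases hki : k = i
      · simp [hki]
      · have : k.rev ≠ i.rev := fun h => hki (Fin.rev_injective h)
        rcases lt_or_gt_of_ne this with h | h
        · simp [hki, h, h.le]
        · simp [hki, h.not_ge, h.not_gt]
    rw [Finset.sum_congr rfl fun k _ => by rw [hsum k]]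
    simp
  congr 1
  · rw [map_prod, sumPoly, map_prod]
    refine Finset.prod_congr rfl fun i _ => ?_
    rw [map_pow, map_pow, aeval_X, hY]
  · rw [sumPoly, map_prod, map_prod]
    refine Finset.prod_congr rfl fun i _ => ?_
    rw [map_pow, map_pow, map_sum, map_sum]
    simp only [rename_X, aeval_X]
    rw [hX]

end Polynomials

/-! ### Words with trivial upper or trivial lower indices -/

/-- The projection onto the words with upper indices `1`. -/
def projLow : QA →ₗ[ℚ] Stuffle ℕ :=
  lift fun w => if ∀ a ∈ w, a.1 = 1 then word (w.map Prod.snd) else 0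

/-- The projection onto the words with lower indices `0`. -/
def projUp : QA →ₗ[ℚ] H1 :=
  lift fun w => if ∀ a ∈ w, a.2 = 0 then word (w.map Prod.fst) else 0

/-- The inclusion of the words with upper indices `1`. -/
def inclLow : Stuffle ℕ →ₗ[ℚ] QA := lift fun u => word (u.map fun d => ((1 : ℕ+), d))

@[simp] lemma projLow_nil : projLow (word []) = word [] := by simp [projLow]

@[simp] lemma projUp_nil : projUp (word []) = word [] := by simp [projUp]

@[simp] lemma inclLow_word (u : List ℕ) :
    inclLow (word u) = word (u.map fun d => ((1 : ℕ+), d)) := by simp [inclLow]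

@[simp] lemma inclQA_word (w : List ℕ+) : inclQA (word w) = word (w.map fun k => (k, 0)) := by
  simp [inclQA]

lemma projLow_cons (a : Letter) (x : QA) :
    projLow (cons a x) = if a.1 = 1 then cons a.2 (projLow x) else 0 := by
  have h : projLow.comp (cons a) = if a.1 = 1 then (cons a.2).comp projLow else 0 := by
    refine hom_ext fun w => ?_
    rw [LinearMap.comp_apply, cons_word, projLow, lift_word]
    by_cases ha : a.1 = 1
    · by_cases hw : ∀ b ∈ w, b.1 = 1
      · rw [if_pos (by simpa only [List.forall_mem_cons] using ⟨ha, hw⟩), if_pos ha,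
          LinearMap.comp_apply, lift_word,
          if_pos hw, cons_word, List.map_cons]
      · rw [if_neg fun h => hw fun b hb => h b (List.mem_cons_of_mem _ hb), if_pos ha,
          LinearMap.comp_apply,
          lift_word, if_neg hw, map_zero]
    · rw [if_neg fun h => ha (h a List.mem_cons_self), if_neg ha, LinearMap.zero_apply]
  have := congrArg (fun f => f x) h
  simp only [LinearMap.comp_apply] at this
  rw [this]; split_ifs <;> rfl

lemma projUp_cons (a : Letter) (x : QA) :
    projUp (cons a x) = if a.2 = 0 then cons a.1 (projUp x) else 0 := by
  have h : projUp.comp (cons a) = if a.2 = 0 then (cons a.1).comp projUp else 0 := by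
    refine hom_ext fun w => ?_
    rw [LinearMap.comp_apply, cons_word, projUp, lift_word]
    by_cases ha : a.2 = 0
    · by_cases hw : ∀ b ∈ w, b.2 = 0
      · rw [if_pos (by simpa only [List.forall_mem_cons] using ⟨ha, hw⟩), if_pos ha,
          LinearMap.comp_apply, lift_word,
          if_pos hw, cons_word, List.map_cons]
      · rw [if_neg fun h => hw fun b hb => h b (List.mem_cons_of_mem _ hb), if_pos ha,
          LinearMap.comp_apply,
          lift_word, if_neg hw, map_zero]
    · rw [if_neg fun h => ha (h a List.mem_cons_self), if_neg ha, LinearMap.zero_apply]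
  have := congrArg (fun f => f x) h
  simp only [LinearMap.comp_apply] at this
  rw [this]; split_ifs <;> rfl

lemma inclLow_cons (d : ℕ) (x : Stuffle ℕ) : inclLow (cons d x) = cons (1, d) (inclLow x) := by
  have h : inclLow.comp (cons d) = (cons ((1 : ℕ+), d)).comp inclLow := hom_ext fun w => by simp
  exact congrArg (fun f => f x) h

lemma projLow_inclLow (x : Stuffle ℕ) : projLow (inclLow x) = x := by
  have h : projLow.comp inclLow = LinearMap.id := hom_ext fun w => by
    simp [projLow, Function.comp_def]
  exact congrArg (fun f => f x) h

/-- A merged letter has upper index at least `2` and is killed by the projection, so only the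
shuffle part of the stuffle product survives. -/
lemma projLow_mul (x y : QA) : projLow (x * y) = shuffle (projLow x) (projLow y) := by
  have h : stuffle.compr₂ projLow = shuffle.compl₁₂ projLow projLow := by
    refine hom_ext fun u => hom_ext fun v => ?_
    simp only [LinearMap.compr₂_apply, LinearMap.compl₁₂_apply]
    refine word_induction₂ (p := fun u v => projLow (stuffle (word u) (word v))
      = shuffle (projLow (word u)) (projLow (word v))) ?_ ?_ ?_ u v
    · intro v; simp [stuffle_nil_left]
    · intro u; simp [stuffle_nil_right]
    · intro a u b v h1 h2 _
      have hab : (a + b).1 ≠ 1 := by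
        intro h
        have := congrArg PNat.val h
        have h3 := a.1.pos
        have h4 := b.1.pos
        simp only [Prod.fst_add, PNat.add_coe, PNat.one_coe] at this
        omega
      simp only [← cons_word] at h1 h2 ⊢
      rw [stuffle_cons_cons, map_add, map_add, projLow_cons, projLow_cons, projLow_cons, h1, h2,
        if_neg hab, add_zero, projLow_cons, projLow_cons]
      by_cases ha : a.1 = 1 <;> by_cases hb : b.1 = 1 <;> simp [ha, hb, shuffle_cons_cons]
  exact congrArg (fun f => f x y) h

/-- A merged letter has lower index `0` only if both of its parts do, so discarding the other words
respects all three terms of the recursion. -/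
lemma projUp_mul (x y : QA) : projUp (x * y) = projUp x * projUp y := by
  have h : stuffle.compr₂ projUp = stuffle.compl₁₂ projUp projUp := by
    refine hom_ext fun u => hom_ext fun v => ?_
    simp only [LinearMap.compr₂_apply, LinearMap.compl₁₂_apply]
    refine word_induction₂ (p := fun u v => projUp (stuffle (word u) (word v))
      = stuffle (projUp (word u)) (projUp (word v))) ?_ ?_ ?_ u v
    · intro v; simp [stuffle_nil_left]
    · intro u; simp [stuffle_nil_right]
    · intro a u b v h1 h2 h3
      simp only [← cons_word] at h1 h2 ⊢
      rw [stuffle_cons_cons, map_add, map_add, projUp_cons, projUp_cons, projUp_cons, h1, h2, h3,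
        projUp_cons, projUp_cons]
      by_cases ha : a.2 = 0 <;> by_cases hb : b.2 = 0 <;> simp [ha, hb, stuffle_cons_cons]
  exact congrArg (fun f => f x y) h

/-- Commutativity, and associativity below, are inherited from the stuffle product of `ℚ⟨𝒜⟩` through
the projection `projLow` and its section `inclLow`. -/
lemma shuffle_comm (x y : Stuffle ℕ) : shuffle x y = shuffle y x := by
  have := projLow_mul (inclLow x) (inclLow y)
  rw [mul_comm, projLow_mul] at this
  simpa [projLow_inclLow] using this.symm

lemma shuffle_assoc (x y z : Stuffle ℕ) :
    shuffle (shuffle x y) z = shuffle x (shuffle y z) := by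
  have := congrArg projLow (mul_assoc (inclLow x) (inclLow y) (inclLow z))
  simpa [projLow_mul, projLow_inclLow] using this

lemma theta_zeros (r : ℕ) :
    theta (word (List.replicate r 0)) = word (List.replicate r (1 : ℕ+)) := by
  induction r with
  | zero => simp
  | succ r ih =>
    rw [List.replicate_succ', theta_word_snoc, ih, pow_zero, Module.End.one_apply]
    cases r with
    | zero => simp; rfl
    | succ r =>
      have := split_word 0 (List.replicate r (1 : ℕ+))
      rw [Finset.Nat.antidiagonal_zero, Finset.sum_singleton] at this
      exact this

lemma zipWord_ones (u : List ℕ) :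
    zipWord u (word (List.replicate u.length 1)) = inclLow (word u) := by
  rw [zipWord, lift_word, inclLow_word]
  congr 1
  induction u with
  | nil => rfl
  | cons d u ih => simpa [List.replicate_succ] using ih

lemma zipWord_zeros {r : ℕ} {x : H1}
    (hx : x ∈ Submodule.span ℚ (word '' {w : List ℕ+ | w.length = r})) :
    zipWord (List.replicate r 0) x = inclQA x := by
  rw [← sub_eq_zero, ← Submodule.mem_bot ℚ]
  refine map_mem_of_mem_span hx (zipWord (List.replicate r 0) - inclQA.toLinearMap)
    fun w hw => ?_
  rw [Submodule.mem_bot, LinearMap.sub_apply, sub_eq_zero, zipWord, lift_word]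
  refine Eq.trans ?_ (inclQA_word w).symm
  congr 1
  obtain rfl : w.length = r := hw
  clear hx
  induction w with
  | nil => rfl
  | cons d u ih => simpa [List.replicate_succ] using ih

/-- The exchange of upper and lower indices in the special case `v = 0⋯0`, for which `theta v` is
`z_1⋯z_1`. -/
lemma swap_inclLow (x : Stuffle ℕ) : swap (inclLow x) = inclQA (theta x) := by
  have h : swap.comp inclLow = inclQA.toLinearMap.comp theta := by
    refine hom_ext fun u => ?_
    simp only [LinearMap.comp_apply]
    rw [← zipWord_ones, ← theta_zeros, swap_zipWord_theta (by simp),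
      zipWord_zeros (theta_word_mem_span_length u)]
    rfl
  exact congrArg (fun f => f x) h

/-! ### Formal multiple zeta values satisfy the extended double shuffle relations -/

/-- The projection from `ℚ⟨𝒜⟩` onto the formal multiple zeta values. -/
def toZf : QA →ₐ[ℚ] Zf := proj.comp (Ideal.Quotient.mkₐ ℚ swapIdeal)

lemma toZf_swap (x : QA) : toZf (swap x) = toZf x := by
  have h : Ideal.Quotient.mk swapIdeal (swap x) = Ideal.Quotient.mk swapIdeal x :=
    Ideal.Quotient.eq.2 (Ideal.subset_span ⟨x, rfl⟩)
  exact congrArg proj h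

lemma toZf_eq_zero {x : QA} (hx : x ∈ idealN) : toZf x = 0 :=
  Ideal.Quotient.eq_zero_iff_mem.2 (Ideal.mem_map_of_mem _ hx)

lemma zetaF_theta (x : Stuffle ℕ) : zetaF (theta x) = toZf (inclLow x) := by
  rw [← toZf_swap, swap_inclLow]; rfl

lemma IsZetaWord.of_cons {a : Letter} {w : List Letter} (h : IsZetaWord (a :: w)) :
    IsZetaWord w := by
  obtain ⟨u, v, huv, hu, hv⟩ := h
  cases u with
  | nil =>
    obtain rfl : a :: w = v := huv
    exact ⟨[], w, rfl, by simp, fun b hb => hv b (List.mem_cons_of_mem _ hb)⟩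
  | cons b u =>
    rw [List.cons_append, List.cons.injEq] at huv
    exact ⟨u, v, huv.2, fun c hc => hu c (List.mem_cons_of_mem _ hc), hv⟩

lemma cons_mem_span (a : Letter) {x : QA}
    (hx : x ∈ Submodule.span ℚ (word '' {w | ¬ IsZetaWord w})) :
    cons a x ∈ Submodule.span ℚ (word '' {w | ¬ IsZetaWord w}) := by
  refine map_mem_of_mem_span hx (cons a) fun w hw => ?_
  rw [cons_word]
  exact Submodule.subset_span ⟨_, fun h => hw h.of_cons, rfl⟩

/-- A letter with upper index other than `1` must belong to the tail of a zeta word, so such a word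
has all lower indices zero. These are the words that `projUp` detects. -/
lemma cons_mem_span_of_projUp {a : Letter} (ha : a.1 ≠ 1) {x : QA}
    (hx : a.2 = 0 → projUp x = 0) :
    cons a x ∈ Submodule.span ℚ (word '' {w | ¬ IsZetaWord w}) := by
  have key : ∀ w : List Letter, ¬ (∀ b ∈ a :: w, b.2 = 0) → ¬ IsZetaWord (a :: w) := by
    rintro w hw ⟨u, v, huv, hu, hv⟩
    cases u with
    | nil =>
      obtain rfl : a :: w = v := huv
      exact hw hv
    | cons b u =>
      rw [List.cons_append, List.cons.injEq] at huv
      exact ha (huv.1 ▸ hu b (by simp))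
  by_cases h0 : a.2 = 0
  · let J : H1 →ₗ[ℚ] QA := lift fun w => word (w.map fun k => (k, 0))
    have h : (cons a).comp (LinearMap.id - J.comp projUp) x
        ∈ Submodule.span ℚ (word '' {w | ¬ IsZetaWord w}) := by
      refine map_mem_of_forall_word _ (fun w => ?_) x
      rw [LinearMap.comp_apply, LinearMap.sub_apply, LinearMap.id_apply, LinearMap.comp_apply]
      by_cases hw : ∀ b ∈ w, b.2 = 0
      · have : J (projUp (word w)) = word w := by
          rw [projUp, lift_word, if_pos hw, lift_word, List.map_map]
          congr 1
          conv_rhs => rw [← List.map_id w]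
          refine List.map_congr_left fun b hb => ?_
          exact Prod.ext rfl (hw b hb).symm
        rw [this, sub_self, map_zero]
        exact Submodule.zero_mem _
      · rw [projUp, lift_word, if_neg hw, map_zero, sub_zero, cons_word]
        exact Submodule.subset_span
          ⟨_, key w fun h' => hw fun b hb => h' b (List.mem_cons_of_mem _ hb), rfl⟩
    rwa [LinearMap.comp_apply, LinearMap.sub_apply, LinearMap.id_apply, LinearMap.comp_apply,
      hx h0, map_zero, sub_zero] at h
  · refine map_mem_of_forall_word (cons a) (fun w => ?_) x
    rw [cons_word]
    exact Submodule.subset_span ⟨_, key w fun h => h0 (h a (by simp)), rfl⟩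

lemma mem_idealN_of_mem_span {x : QA} (hx : x ∈ Submodule.span ℚ (word '' {w | ¬ IsZetaWord w})) :
    x ∈ idealN := by
  refine map_mem_of_mem_span hx LinearMap.id (S := idealN.restrictScalars ℚ) fun w hw => ?_
  exact Ideal.subset_span ⟨w, hw, rfl⟩

/-- Up to words which vanish as formal multiple zeta values, the stuffle product of words with upper
indices `1` is the shuffle product, if one of them does not end in the letter `(1, 0)`. -/
lemma inclLow_mul_sub_mem (u v : List ℕ) (hv : v.getLast? ≠ some 0) :
    inclLow (word u) * inclLow (word v) - inclLow (shuffle (word u) (word v)) ∈ idealN := by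
  refine mem_idealN_of_mem_span ?_
  revert hv
  refine word_induction₂ (p := fun u v => v.getLast? ≠ some 0 →
    inclLow (word u) * inclLow (word v) - inclLow (shuffle (word u) (word v))
      ∈ Submodule.span ℚ (word '' {w | ¬ IsZetaWord w})) ?_ ?_ ?_ u v
  · intro v _
    simp [mul_def, stuffle_nil_left]
  · intro u _
    simp [mul_def, stuffle_nil_right]
  · intro a u b v h1 h2 _ hv
    have hv' : v.getLast? ≠ some 0 := by
      cases v with
      | nil => simp
      | cons c v => simpa using hv
    have h1 := h1 hv
    have h2 := h2 hv'
    -- The merged letter has upper index `2`. If its lower index vanishes then `b = 0`, so `v` is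
    -- nonempty and still ends in a nonzero index, which makes `projUp` of the product zero.
    have h3 : cons ((1, a) + (1, b)) (inclLow (word u) * inclLow (word v))
        ∈ Submodule.span ℚ (word '' {w | ¬ IsZetaWord w}) := by
      refine cons_mem_span_of_projUp (by simp; decide) fun hab => ?_
      have hb : b = 0 := (Nat.add_eq_zero_iff.1 hab).2
      have hne : v ≠ [] := by rintro rfl; simp [hb] at hv
      have : projUp (inclLow (word v)) = 0 := by
        rw [inclLow_word, projUp, lift_word, if_neg]
        intro hall
        obtain ⟨v, c, rfl⟩ := (List.eq_nil_or_concat v).resolve_left hne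
        have := hall (1, c) (by simp)
        simp_all
      rw [projUp_mul, this, mul_zero]
    simp only [mul_def, ← cons_word, inclLow_cons] at h1 h2 h3 ⊢
    rw [stuffle_cons_cons, shuffle_cons_cons, map_add, inclLow_cons, inclLow_cons]
    have := Submodule.add_mem _ (Submodule.add_mem _ (cons_mem_span (1, a) h1)
      (cons_mem_span (1, b) h2)) h3
    convert this using 1
    simp only [map_sub]
    abel

/-- The words not starting in `z_1` are closed under stuffle, because a merged first letter is at
least `z_2`; so the algebra they generate is their span. -/
lemma mem_span_of_mem_H0 {v : H1} (hv : v ∈ H0) :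
    v ∈ Submodule.span ℚ (word '' {w : List ℕ+ | w.head? ≠ some 1}) := by
  have hmul : ∀ u v : List ℕ+, u.head? ≠ some 1 → v.head? ≠ some 1 →
      word u * word v ∈ Submodule.span ℚ (word '' {w : List ℕ+ | w.head? ≠ some 1}) := by
    intro u v hu hv
    have hcons : ∀ (a : ℕ+) (x : H1), a ≠ 1 →
        cons a x ∈ Submodule.span ℚ (word '' {w : List ℕ+ | w.head? ≠ some 1}) := by
      intro a x ha
      refine map_mem_of_forall_word (cons a) (fun w => ?_) x
      rw [cons_word]
      exact Submodule.subset_span ⟨_, by simpa using ha, rfl⟩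
    match u, v with
    | [], v => exact Submodule.subset_span ⟨v, hv, by simp [mul_def, stuffle_nil_left]⟩
    | a :: u, [] => exact Submodule.subset_span ⟨_, hu, by simp [mul_def, stuffle_nil_right]⟩
    | a :: u, b :: v =>
      rw [word_mul_word, stuffleWord]
      have ha : a ≠ 1 := by simpa using hu
      have hb : b ≠ 1 := by simpa using hv
      refine Submodule.add_mem _ (Submodule.add_mem _ (hcons _ _ ha) (hcons _ _ hb))
        (hcons _ _ ?_)
      intro h
      have := congrArg PNat.val h
      have h3 := a.pos
      have h4 := b.pos
      simp only [PNat.add_coe, PNat.one_coe] at this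
      omega
  refine Algebra.adjoin_induction ?_ ?_ ?_ ?_ hv
  · rintro _ ⟨w, hw, rfl⟩
    exact Submodule.subset_span ⟨w, hw, rfl⟩
  · intro c
    rw [Algebra.algebraMap_eq_smul_one]
    exact Submodule.smul_mem _ _ (Submodule.subset_span ⟨[], by simp, rfl⟩)
  · intro x y _ _ hx hy
    exact Submodule.add_mem _ hx hy
  · intro x y _ _ hx hy
    refine map_mem_of_mem_span hx (LinearMap.mulRight ℚ y) fun u hu => ?_
    exact map_mem_of_mem_span hy (LinearMap.mulLeft ℚ (word u)) fun v hv => hmul u v hu hv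

/-- The shuffle product of `𝔥¹` as a bilinear map. -/
def shLin : H1 →ₗ[ℚ] H1 →ₗ[ℚ] H1 := (shuffle.compl₁₂ inclXY inclXY).compr₂ retractXY

lemma shLin_apply (w v : H1) : shLin w v = sh w v := rfl

/-- On images of `theta` the stuffle product becomes, after the swap, a stuffle of words with upper
indices `1`. Modulo `𝔑` this is a shuffle, which `theta` carries to `⧢`. The general case follows by
linearity from the spanning property of `theta`. -/
lemma zetaF_mul_eq_sh (w v : H1) (hv : v ∈ H0) : zetaF (w * v) = zetaF (sh w v) := by
  have h1 : ∀ u v : List ℕ, v.getLast? ≠ some 0 →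
      zetaF (theta (word u) * theta (word v)) = zetaF (sh (theta (word u)) (theta (word v))) := by
    intro u v hv
    rw [← theta_shuffle, map_mul, zetaF_theta, zetaF_theta, zetaF_theta, ← map_mul, ← sub_eq_zero,
      ← map_sub]
    exact toZf_eq_zero (inclLow_mul_sub_mem u v hv)
  have h2 : ∀ (w : H1) (v : List ℕ), v.getLast? ≠ some 0 →
      zetaF (w * theta (word v)) = zetaF (sh w (theta (word v))) := by
    intro w v hv
    have : zetaF.toLinearMap.comp (LinearMap.mulRight ℚ (theta (word v)))
        = zetaF.toLinearMap.comp (shLin.flip (theta (word v))) := by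
      refine hom_ext fun k => ?_
      refine (Submodule.span_le (p := LinearMap.eqLocus
        (zetaF.toLinearMap.comp (LinearMap.mulRight ℚ (theta (word v))))
        (zetaF.toLinearMap.comp (shLin.flip (theta (word v)))))).2 ?_
        (word_mem_span_theta_length k)
      rintro _ ⟨u, -, rfl⟩
      exact h1 u v hv
    exact congrArg (fun f => f w) this
  rw [← sub_eq_zero, ← map_sub, ← Submodule.mem_bot ℚ]
  refine map_mem_of_mem_span (mem_span_of_mem_H0 hv)
    (zetaF.toLinearMap.comp (LinearMap.mulLeft ℚ w - shLin w)) fun k hk => ?_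
  rw [Submodule.mem_bot, LinearMap.comp_apply, LinearMap.sub_apply, map_sub, sub_eq_zero]
  cases k with
  | nil => simpa [shLin_apply] using h2 w [] (by simp)
  | cons k l =>
    obtain ⟨n, rfl⟩ := exists_succPNat k
    have hn : n ≠ 0 := by rintro rfl; exact hk rfl
    -- The bound `n ≤ d` in `word_mem_span_theta`, with `n ≠ 0`, ensures that the preimages do not
    -- end in `0`.
    refine (Submodule.span_le (p := LinearMap.eqLocus
      (zetaF.toLinearMap.comp (LinearMap.mulLeft ℚ w))
      (zetaF.toLinearMap.comp (shLin w)))).2 ?_ (word_mem_span_theta l n)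
    rintro _ ⟨u, d, -, hd, rfl⟩
    exact h2 w (u ++ [d]) (by simp; omega)

/-! ### Iterated removal of letters -/

/-- Iterated removal replaces the condition that a suffix consists of zeros by a linear operator.
With `dropOne_pow_word_append`, this expresses the supports of `projUp` and `projLow` linearly. -/
lemma trim_pow_word_append (u v : List ℕ) :
    (trim ^ v.length) (word (u ++ v)) = if ∀ d ∈ v, d = 0 then word u else 0 := by
  induction v using List.reverseRecOn with
  | nil => simp
  | append_singleton v d ih =>
    rw [List.length_append, List.length_singleton, pow_succ, Module.End.mul_apply,
      ← List.append_assoc, trim_word_snoc]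
    by_cases hd : d = 0
    · rw [if_pos hd, ih]
      by_cases hv : ∀ d ∈ v, d = 0
      · rw [if_pos hv, if_pos]
        intro e he
        rcases List.mem_append.1 he with h | h
        · exact hv e h
        · exact (List.mem_singleton.1 h).trans hd
      · rw [if_neg hv, if_neg fun h => hv fun e he => h e (List.mem_append_left _ he)]
    · rw [if_neg hd, map_zero, if_neg fun h => hd (h d (by simp))]

lemma trim_pow_length_succ (u : List ℕ) : (trim ^ (u.length + 1)) (word u) = 0 := by
  have := trim_pow_word_append [] u
  rw [List.nil_append] at this
  rw [pow_succ', Module.End.mul_apply, this]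
  split_ifs <;> simp

lemma trim_pow_zeros (j m : ℕ) : (trim ^ j) (word (List.replicate (m + j) 0))
    = word (List.replicate m 0) := by
  have := trim_pow_word_append (List.replicate m 0) (List.replicate j 0)
  rw [List.length_replicate, if_pos fun d hd => List.eq_of_mem_replicate hd] at this
  rwa [List.replicate_add]

lemma dropOne_pow_word_append (k l : List ℕ+) :
    (dropOne ^ k.length) (word (k ++ l)) = if ∀ a ∈ k, a = 1 then word l else 0 := by
  induction k with
  | nil => simp
  | cons a k ih =>
    rw [List.length_cons, pow_succ, Module.End.mul_apply, List.cons_append]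
    obtain ⟨n, rfl⟩ := exists_succPNat a
    cases n with
    | zero =>
      rw [dropOne_word_zero, ih]
      by_cases hk : ∀ a ∈ k, a = 1
      · rw [if_pos hk, if_pos]
        intro b hb
        rcases List.mem_cons.1 hb with rfl | h
        · rfl
        · exact hk b h
      · rw [if_neg hk, if_neg fun h => hk fun b hb => h b (List.mem_cons_of_mem _ hb)]
    | succ n =>
      rw [dropOne_word_succ, map_zero, if_neg]
      intro h
      have := congrArg PNat.val (h _ List.mem_cons_self)
      simp at this

lemma dropOne_pow_theta (i : ℕ) (x : Stuffle ℕ) :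
    (dropOne ^ i) (theta x) = theta ((trim ^ i) x) := by
  induction i with
  | zero => simp
  | succ i ih => rw [pow_succ', Module.End.mul_apply, ih, dropOne_theta, pow_succ',
      Module.End.mul_apply]

lemma trim_pow_shuffle {x : Stuffle ℕ} (hx : trim x = 0) (j : ℕ) (y : Stuffle ℕ) :
    (trim ^ j) (shuffle x y) = shuffle x ((trim ^ j) y) := by
  induction j with
  | zero => simp
  | succ j ih => rw [pow_succ', Module.End.mul_apply, ih, trim_shuffle, hx, map_zero,
      LinearMap.zero_apply, zero_add, Module.End.mul_apply]

lemma exists_trim_pow_eq_zero (x : Stuffle ℕ) : ∃ N, (trim ^ N) x = 0 := by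
  induction x using induction_word with
  | add x y hx hy =>
    obtain ⟨M, hM⟩ := hx
    obtain ⟨N, hN⟩ := hy
    refine ⟨M + N, ?_⟩
    have h1 : (trim ^ (M + N)) x = 0 := by
      rw [add_comm, pow_add, Module.End.mul_apply, hM, map_zero]
    have h2 : (trim ^ (M + N)) y = 0 := by
      rw [pow_add, Module.End.mul_apply, hN, map_zero]
    rw [map_add, h1, h2, add_zero]
  | smul_word c u => exact ⟨u.length + 1, by rw [map_smul, trim_pow_length_succ, smul_zero]⟩

/-- The words in the lower indices are polynomials in the word `0` for the shuffle product, with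
coefficients that are killed by `trim`. -/
lemma mem_span_shuffle_zeros (N : ℕ) : ∀ x : Stuffle ℕ, (trim ^ N) x = 0 →
    x ∈ Submodule.span ℚ {z | ∃ y m, trim y = 0 ∧ m < N ∧
      z = shuffle y (word (List.replicate m 0))} := by
  induction N with
  | zero =>
    intro x hx
    rw [pow_zero, Module.End.one_apply] at hx
    rw [hx]
    exact Submodule.zero_mem _
  | succ N ih =>
    intro x hx
    have hy : trim ((trim ^ N) x) = 0 := by
      rwa [pow_succ', Module.End.mul_apply] at hx
    -- `trim` acts as the derivative with respect to the word `0`, whose divided powers are `0⋯0`.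
    -- Hence `trim ^ N` reads off the leading coefficient, which is subtracted.
    have h0 : (trim ^ N) (x - shuffle ((trim ^ N) x) (word (List.replicate N 0))) = 0 := by
      have := trim_pow_zeros N 0
      rw [zero_add] at this
      rw [map_sub, trim_pow_shuffle hy, this, List.replicate_zero, shuffle_nil_right, sub_self]
    have h1 := Submodule.add_mem _ (Submodule.span_mono (by
      rintro _ ⟨y, m, hy, hm, rfl⟩
      exact ⟨y, m, hy, hm.trans (Nat.lt_succ_self N), rfl⟩) (ih _ h0))
      (Submodule.subset_span (R := ℚ) (s := {z | ∃ y m, trim y = 0 ∧ m < N + 1 ∧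
        z = shuffle y (word (List.replicate m 0))}) ⟨_, N, hy, Nat.lt_succ_self N, rfl⟩)
    rwa [sub_add_cancel] at h1

/-- The scalar is a binomial coefficient; only its existence matters, since the regularization kills
nonempty words of zeros. -/
lemma shuffle_zeros (m n : ℕ) : ∃ c : ℚ,
    shuffle (word (List.replicate m 0)) (word (List.replicate n 0))
      = c • word (List.replicate (m + n) 0) := by
  induction m generalizing n with
  | zero => exact ⟨1, by simp⟩
  | succ m ihm =>
    induction n with
    | zero => exact ⟨1, by simp⟩
    | succ n ihn =>
      obtain ⟨c, hc⟩ := ihm (n + 1)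
      obtain ⟨d, hd⟩ := ihn
      refine ⟨c + d, ?_⟩
      rw [List.replicate_succ, ← cons_word] at hd
      rw [List.replicate_succ (n := n), ← cons_word] at hc
      rw [List.replicate_succ, List.replicate_succ, ← cons_word, ← cons_word, shuffle_cons_cons,
        hc, hd, map_smul, map_smul, cons_word, cons_word, ← List.replicate_succ,
        ← List.replicate_succ, add_smul]
      congr 3; congr 1; omega

/-- Subtracting the words that start in `z_1` projects onto `𝔥⁰`; here that part is zero, because
`dropOne` of `theta x` is `theta` of `trim x`. -/
lemma theta_mem_H0 {x : Stuffle ℕ} (hx : trim x = 0) : theta x ∈ H0 := by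
  have h : (LinearMap.id - (cons 1).comp dropOne : H1 →ₗ[ℚ] H1) (theta x)
      ∈ Subalgebra.toSubmodule H0 := by
    refine map_mem_of_forall_word _ (fun w => ?_) (theta x)
    rw [LinearMap.sub_apply, LinearMap.id_apply, LinearMap.comp_apply, Subalgebra.mem_toSubmodule]
    cases w with
    | nil =>
      rw [dropOne_nil, map_zero, sub_zero]
      exact Algebra.subset_adjoin ⟨[], by simp, rfl⟩
    | cons k w =>
      obtain ⟨n, rfl⟩ := exists_succPNat k
      cases n with
      | zero =>
        have : word (Nat.succPNat 0 :: w) - cons 1 (word w) = 0 := by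
          rw [cons_word]; exact sub_self _
        rw [dropOne_word_zero, this]
        exact Subalgebra.zero_mem _
      | succ n =>
        rw [dropOne_word_succ, map_zero, sub_zero]
        refine Algebra.subset_adjoin ⟨_, fun h => ?_, rfl⟩
        have := congrArg PNat.val (Option.some.inj h)
        simp at this
  rwa [LinearMap.sub_apply, LinearMap.id_apply, LinearMap.comp_apply, dropOne_theta, hx, map_zero,
    map_zero, sub_zero, Subalgebra.mem_toSubmodule] at h

/-! ### Realizations of the extended double shuffle relations -/

section Realization

variable {R : Type} [CommRing R] [Algebra ℚ R] (c : H1 →ₐ[ℚ] R)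

/-- The generating series of the values at the words `z_1 ⋯ z_1`. -/
def onesSeries : PowerSeries R := PowerSeries.mk fun j => c (word (List.replicate j 1))

/-- The inverse of the generating series of the values at the words `z_1 ⋯ z_1`. -/
def onesInv : PowerSeries R := PowerSeries.invOfUnit (onesSeries c) 1

lemma sum_onesInv_mul (m : ℕ) : ∑ j ∈ Finset.range (m + 1),
    PowerSeries.coeff j (onesInv c) * c (word (List.replicate (m - j) 1))
      = if m = 0 then 1 else 0 := by
  have h0 : c (word []) = 1 := map_one c
  have h : onesSeries c * onesInv c = 1 :=
    PowerSeries.mul_invOfUnit _ 1 (by simp [onesSeries, h0])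
  have := congrArg (PowerSeries.coeff m) h
  rw [mul_comm, PowerSeries.coeff_mul, PowerSeries.coeff_one,
    Finset.Nat.sum_antidiagonal_eq_sum_range_succ_mk] at this
  simpa [onesSeries] using this

lemma coeff_zero_onesInv : PowerSeries.coeff 0 (onesInv c) = 1 := by
  have h0 : c (word []) = 1 := map_one c
  simpa [h0] using sum_onesInv_mul c 0

/-- The values at the words in the lower indices, regularized by the value zero at the word `0`. -/
def lowReg : Stuffle ℕ →ₗ[ℚ] R := lift fun u => ∑ j ∈ Finset.range (u.length + 1),
  PowerSeries.coeff j (onesInv c) * c (theta ((trim ^ j) (word u)))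

/-- Terms beyond the order of nilpotency vanish, so any cutoff that kills `x` serves, whereas the
definition fixes one for each word. -/
lemma lowReg_eq (x : Stuffle ℕ) (N : ℕ) (hx : (trim ^ N) x = 0) : lowReg c x
    = ∑ j ∈ Finset.range N, PowerSeries.coeff j (onesInv c) * c (theta ((trim ^ j) x)) := by
  have hvan : ∀ (x : Stuffle ℕ) (N M : ℕ), (trim ^ N) x = 0 → N ≤ M →
      ∑ j ∈ Finset.range M, PowerSeries.coeff j (onesInv c) * c (theta ((trim ^ j) x))
      = ∑ j ∈ Finset.range N, PowerSeries.coeff j (onesInv c) * c (theta ((trim ^ j) x)) := by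
    intro x N M hx hNM
    refine (Finset.sum_subset (Finset.range_mono hNM) fun j _ hj => ?_).symm
    obtain ⟨k, rfl⟩ := Nat.exists_eq_add_of_le (not_lt.1 fun h => hj (Finset.mem_range.2 h))
    rw [add_comm, pow_add, Module.End.mul_apply, hx, map_zero, map_zero, map_zero, mul_zero]
  obtain ⟨M, hM⟩ : ∃ M, ∀ K, M ≤ K → lowReg c x
      = ∑ j ∈ Finset.range K, PowerSeries.coeff j (onesInv c) * c (theta ((trim ^ j) x)) := by
    clear hx
    induction x using induction_word with
    | add x y hx hy =>
      obtain ⟨M, hM⟩ := hx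
      obtain ⟨M', hM'⟩ := hy
      refine ⟨max M M', fun K hK => ?_⟩
      rw [map_add, hM K (le_of_max_le_left hK), hM' K (le_of_max_le_right hK),
        ← Finset.sum_add_distrib]
      simp only [map_add, mul_add]
    | smul_word a u =>
      refine ⟨u.length + 1, fun K hK => ?_⟩
      have := hvan (word u) _ K (trim_pow_length_succ u) hK
      simp only [map_smul, mul_smul_comm, ← Finset.smul_sum]
      rw [this, lowReg, lift_word]
  rw [hM (max M N) (le_max_left _ _), hvan x N _ hx (le_max_right _ _)]

lemma lowReg_of_trim {x : Stuffle ℕ} (hx : trim x = 0) : lowReg c x = c (theta x) := by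
  rw [lowReg_eq c x 1 (by simpa using hx)]
  simp [coeff_zero_onesInv]

lemma map_theta_shuffle (hc : ∀ w, ∀ v ∈ H0, c (w * v) = c (sh w v))
    (y : Stuffle ℕ) {x : Stuffle ℕ} (hx : trim x = 0) :
    c (theta (shuffle x y)) = c (theta x) * c (theta y) := by
  rw [shuffle_comm, theta_shuffle, ← hc _ _ (theta_mem_H0 hx), map_mul, mul_comm]

/-- `trim` passes to the zeros and `c` is multiplicative against `theta x`, so the sum is `c (theta
x)` times a coefficient of the product of the series of the `c(z_1^j)` with its inverse. -/
lemma lowReg_shuffle_zeros (hc : ∀ w, ∀ v ∈ H0, c (w * v) = c (sh w v))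
    {x : Stuffle ℕ} (hx : trim x = 0) (m : ℕ) :
    lowReg c (shuffle x (word (List.replicate m 0))) = if m = 0 then c (theta x) else 0 := by
  have hN : (trim ^ (m + 1)) (shuffle x (word (List.replicate m 0))) = 0 := by
    have := trim_pow_length_succ (List.replicate m 0)
    rw [List.length_replicate] at this
    rw [trim_pow_shuffle hx, this, map_zero]
  have hterm : ∀ j ∈ Finset.range (m + 1), PowerSeries.coeff j (onesInv c)
      * c (theta ((trim ^ j) (shuffle x (word (List.replicate m 0)))))
      = (PowerSeries.coeff j (onesInv c) * c (word (List.replicate (m - j) 1))) * c (theta x) := by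
    intro j hj
    have hjm : m - j + j = m := Nat.sub_add_cancel (Nat.lt_succ_iff.1 (Finset.mem_range.1 hj))
    have := trim_pow_zeros j (m - j)
    rw [hjm] at this
    rw [trim_pow_shuffle hx, this, map_theta_shuffle c hc _ hx, theta_zeros]
    ring
  rw [lowReg_eq c _ _ hN, Finset.sum_congr rfl hterm, ← Finset.sum_mul, sum_onesInv_mul]
  split_ifs <;> simp

/-- Every element is a polynomial in the word `0` with coefficients killed by `trim`. On such
coefficients, which are closed under shuffle, `lowReg` is the multiplicative map given by `c` and
`theta`; words of zeros of positive length are sent to `0`. -/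
lemma lowReg_shuffle (hc : ∀ w, ∀ v ∈ H0, c (w * v) = c (sh w v))
    (x y : Stuffle ℕ) :
    lowReg c (shuffle x y) = lowReg c x * lowReg c y := by
  have key : ∀ (x y : Stuffle ℕ) (m n : ℕ), trim x = 0 → trim y = 0 →
      lowReg c (shuffle (shuffle x (word (List.replicate m 0)))
        (shuffle y (word (List.replicate n 0))))
      = lowReg c (shuffle x (word (List.replicate m 0)))
        * lowReg c (shuffle y (word (List.replicate n 0))) := by
    intro x y m n hx hy
    obtain ⟨a, ha⟩ := shuffle_zeros m n
    have hxy : trim (shuffle x y) = 0 := by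
      rw [trim_shuffle, hx, hy, map_zero, map_zero, LinearMap.zero_apply, add_zero]
    have e : shuffle (shuffle x (word (List.replicate m 0)))
        (shuffle y (word (List.replicate n 0)))
        = shuffle (shuffle x y) (shuffle (word (List.replicate m 0)) (word (List.replicate n 0)))
        := by
      rw [shuffle_assoc, ← shuffle_assoc _ y, shuffle_comm _ y, shuffle_assoc y, ← shuffle_assoc]
    rw [e, lowReg_shuffle_zeros c hc hx, lowReg_shuffle_zeros c hc hy]
    by_cases hm : m = 0
    · by_cases hn : n = 0
      · subst hm hn
        simp [lowReg_of_trim c hxy, map_theta_shuffle c hc y hx]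
      · rw [ha, map_smul, map_smul, lowReg_shuffle_zeros c hc hxy]
        simp [hn]
    · rw [ha, map_smul, map_smul, lowReg_shuffle_zeros c hc hxy]
      simp [hm]
  obtain ⟨M, hM⟩ := exists_trim_pow_eq_zero x
  obtain ⟨N, hN⟩ := exists_trim_pow_eq_zero y
  have h1 : ∀ (y : Stuffle ℕ) (n : ℕ), trim y = 0 →
      lowReg c (shuffle x (shuffle y (word (List.replicate n 0))))
      = lowReg c x * lowReg c (shuffle y (word (List.replicate n 0))) := by
    intro y n hy
    refine LinearMap.eqOn_span
      (f := (lowReg c).comp (shuffle.flip (shuffle y (word (List.replicate n 0)))))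
      (g := (LinearMap.mulRight ℚ (lowReg c (shuffle y (word (List.replicate n 0))))).comp
        (lowReg c)) ?_ (mem_span_shuffle_zeros M x hM)
    rintro _ ⟨x, m, hx, -, rfl⟩
    exact key x y m n hx hy
  refine LinearMap.eqOn_span (f := (lowReg c).comp (shuffle x))
    (g := (LinearMap.mulLeft ℚ (lowReg c x)).comp (lowReg c)) ?_ (mem_span_shuffle_zeros N y hN)
  rintro _ ⟨y, n, hy, -, rfl⟩
  exact h1 y n hy

/-- The regularization determines the values at all words. -/
lemma map_theta_eq_sum (hc : ∀ w, ∀ v ∈ H0, c (w * v) = c (sh w v))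
    (x : Stuffle ℕ) (N : ℕ) (hx : (trim ^ N) x = 0) : c (theta x)
    = ∑ j ∈ Finset.range N, c (word (List.replicate j 1)) * lowReg c ((trim ^ j) x) := by
  have h : ∀ x : Stuffle ℕ,
      (∑ j ∈ Finset.range N, (LinearMap.mulLeft ℚ (c (word (List.replicate j 1)))).comp
        ((lowReg c).comp (trim ^ j))) x
      = ∑ j ∈ Finset.range N, c (word (List.replicate j 1)) * lowReg c ((trim ^ j) x) := by
    intro x
    rw [LinearMap.sum_apply]
    rfl
  rw [← h]
  refine LinearMap.eqOn_span (f := c.toLinearMap.comp theta) ?_ (mem_span_shuffle_zeros N x hx)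
  rintro _ ⟨y, m, hy, hm, rfl⟩
  -- For `j < m` some zeros remain and `lowReg` kills them; for `j > m` the operator `trim ^ j`
  -- already gives zero.
  rw [h, Finset.sum_eq_single m]
  · have := trim_pow_zeros m 0
    rw [zero_add, List.replicate_zero] at this
    rw [trim_pow_shuffle hy, this, shuffle_nil_right, lowReg_of_trim c hy]
    change c (theta _) = _
    rw [map_theta_shuffle c hc _ hy, theta_zeros, mul_comm]
  · intro j _ hj
    rw [trim_pow_shuffle hy]
    rcases lt_or_gt_of_ne hj with h | h
    · have := trim_pow_zeros j (m - j)
      rw [Nat.sub_add_cancel h.le] at this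
      rw [this, lowReg_shuffle_zeros c hc hy, if_neg (by omega), mul_zero]
    · have := trim_pow_length_succ (List.replicate m 0)
      rw [List.length_replicate] at this
      obtain ⟨k, rfl⟩ := Nat.exists_eq_add_of_le (Nat.succ_le_of_lt h)
      rw [Nat.succ_eq_add_one, add_comm, pow_add, Module.End.mul_apply, this, map_zero, map_zero,
        map_zero, mul_zero]
  · intro h
    exact absurd (Finset.mem_range.2 hm) h

/-! ### The extension of a realization to words with two rows of indices -/

/-- The regularized values at the words with upper indices `1`, extended by zero. -/
def lowHom (hc : ∀ w, ∀ v ∈ H0, c (w * v) = c (sh w v)) : QA →ₐ[ℚ] R :=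
  AlgHom.ofLinearMap ((lowReg c).comp projLow)
    (by
      rw [one_def, LinearMap.comp_apply, projLow_nil, lowReg_of_trim c trim_nil, theta_nil]
      exact map_one c)
    (fun x y => by
      rw [LinearMap.comp_apply, projLow_mul, lowReg_shuffle c hc]; rfl)

/-- The values at the words with lower indices `0`, extended by zero. -/
def upHom : QA →ₐ[ℚ] R :=
  c.comp (AlgHom.ofLinearMap projUp (by rw [one_def, projUp_nil]; rfl) projUp_mul)

/-- The extension of a realization of the extended double shuffle relations to `ℚ⟨𝒜⟩`. -/
def extension (hc : ∀ w, ∀ v ∈ H0, c (w * v) = c (sh w v)) : QA →ₐ[ℚ] R :=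
  (Algebra.TensorProduct.productMap (lowHom c hc) (upHom c)).comp deconcat

lemma extension_word (hc : ∀ w, ∀ v ∈ H0, c (w * v) = c (sh w v)) (w : List Letter) :
    extension c hc (word w) = ∑ i ∈ Finset.range (w.length + 1),
      lowReg c (projLow (word (w.take i))) * c (projUp (word (w.drop i))) := by
  rw [extension, AlgHom.comp_apply, deconcat_word, map_sum]
  refine Finset.sum_congr rfl fun i _ => ?_
  rw [Algebra.TensorProduct.productMap_apply_tmul]
  rfl

lemma extension_of_not_isZetaWord (hc : ∀ w, ∀ v ∈ H0, c (w * v) = c (sh w v))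
    {w : List Letter} (hw : ¬ IsZetaWord w) : extension c hc (word w) = 0 := by
  rw [extension_word]
  refine Finset.sum_eq_zero fun i _ => ?_
  by_cases h1 : ∀ a ∈ w.take i, a.1 = 1
  · have h2 : ¬ ∀ a ∈ w.drop i, a.2 = 0 := fun h2 =>
      hw ⟨_, _, (List.take_append_drop i w).symm, h1, h2⟩
    rw [projUp, lift_word, if_neg h2, map_zero, mul_zero]
  · rw [projLow, lift_word, if_neg h1, map_zero, zero_mul]

lemma lowReg_zeros (hc : ∀ w, ∀ v ∈ H0, c (w * v) = c (sh w v)) {m : ℕ} (hm : m ≠ 0) :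
    lowReg c (word (List.replicate m 0)) = 0 := by
  simpa [hm] using lowReg_shuffle_zeros c hc trim_nil m

lemma projLow_zip {k : List ℕ+} {u : List ℕ} (h : k.length = u.length) :
    projLow (word (k.zip u)) = if ∀ a ∈ k, a = 1 then word u else 0 := by
  have h1 : (k.zip u).map Prod.fst = k := List.map_fst_zip h.le
  have h2 : (k.zip u).map Prod.snd = u := List.map_snd_zip h.ge
  have h3 : (∀ a ∈ k.zip u, a.1 = 1) ↔ ∀ a ∈ k, a = 1 := by
    conv_rhs => rw [← h1]
    rw [List.forall_mem_map]
  rw [projLow, lift_word, h2]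
  simp only [h3]

lemma projUp_zip {k : List ℕ+} {u : List ℕ} (h : k.length = u.length) :
    projUp (word (k.zip u)) = if ∀ d ∈ u, d = 0 then word k else 0 := by
  have h1 : (k.zip u).map Prod.fst = k := List.map_fst_zip h.le
  have h2 : (k.zip u).map Prod.snd = u := List.map_snd_zip h.ge
  have h3 : (∀ a ∈ k.zip u, a.2 = 0) ↔ ∀ d ∈ u, d = 0 := by
    conv_rhs => rw [← h2]
    rw [List.forall_mem_map]
  rw [projUp, lift_word, h1]
  simp only [h3]

/-- A nonempty prefix either contains an upper index other than `1` or consists of letters `(1,0)`;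
the regularization kills the latter. Only the empty prefix contributes, so `c` is recovered without
multiple counting of initial letters `z_1`. -/
lemma extension_inclQA (hc : ∀ w, ∀ v ∈ H0, c (w * v) = c (sh w v)) (x : H1) :
    extension c hc (inclQA x) = c x := by
  have h : (extension c hc).toLinearMap.comp inclQA.toLinearMap = c.toLinearMap := by
    refine hom_ext fun k => ?_
    change extension c hc (inclQA (word k)) = c (word k)
    rw [inclQA_word, extension_word, Finset.sum_eq_single 0]
    · have hz : k.map (fun k => (k, 0)) = k.zip (List.replicate k.length 0) := by
        induction k with
        | nil => rfl
        | cons a k ih => simpa [List.replicate_succ] using ih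
      rw [List.take_zero, projLow_nil, lowReg_of_trim c trim_nil, theta_nil, List.drop_zero, hz,
        projUp_zip (by simp), if_pos fun d hd => List.eq_of_mem_replicate hd]
      have h0 : c (word []) = 1 := map_one c
      rw [h0, one_mul]
    · intro i hi hne
      rw [← List.map_take, projLow, lift_word]
      split_ifs
      · have : (k.take i).map (Prod.snd ∘ fun k : ℕ+ => (k, 0))
            = List.replicate (k.take i).length 0 := by
          simp [Function.comp_def]
        rw [List.map_map, this, lowReg_zeros c hc, zero_mul]
        simp only [Finset.mem_range, List.length_map] at hi
        rw [List.length_take]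
        omega
      · rw [map_zero, zero_mul]
    · intro h
      exact absurd (Finset.mem_range.2 (Nat.succ_pos _)) h
  exact congrArg (fun f => f x) h

/-- The support conditions on prefix and suffix become powers of `dropOne` on the upper indices and
of `trim` on the lower ones, which makes the formula linear in `x`. -/
lemma extension_zipWord (hc : ∀ w, ∀ v ∈ H0, c (w * v) = c (sh w v)) (u : List ℕ) {x : H1}
    (hx : x ∈ Submodule.span ℚ (word '' {w : List ℕ+ | w.length = u.length})) :
    extension c hc (zipWord u x) = ∑ i ∈ Finset.range (u.length + 1),
      lowReg c ((trim ^ (u.length - i)) (word u)) * c ((dropOne ^ i) x) := by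
  have h : ∀ x : H1,
      (∑ i ∈ Finset.range (u.length + 1), (LinearMap.mulLeft ℚ
        (lowReg c ((trim ^ (u.length - i)) (word u)))).comp (c.toLinearMap.comp (dropOne ^ i))) x
      = ∑ i ∈ Finset.range (u.length + 1),
        lowReg c ((trim ^ (u.length - i)) (word u)) * c ((dropOne ^ i) x) := by
    intro x
    rw [LinearMap.sum_apply]
    rfl
  rw [← h]
  refine LinearMap.eqOn_span (f := (extension c hc).toLinearMap.comp (zipWord u)) ?_ hx
  rintro _ ⟨k, hk, rfl⟩
  have hk : k.length = u.length := hk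
  rw [h]
  change extension c hc (zipWord u (word k)) = _
  rw [zipWord, lift_word, extension_word, List.length_zip, hk, min_self]
  refine Finset.sum_congr rfl fun i hi => ?_
  have hi : i ≤ u.length := Nat.lt_succ_iff.1 (Finset.mem_range.1 hi)
  have h1 := trim_pow_word_append (u.take i) (u.drop i)
  have h2 := dropOne_pow_word_append (k.take i) (k.drop i)
  rw [List.take_append_drop, List.length_drop] at h1
  rw [List.take_append_drop, List.length_take, min_eq_left (hk ▸ hi)] at h2
  have h3 : (k.zip u).take i = (k.take i).zip (u.take i) := List.take_zipWith
  have h4 : (k.zip u).drop i = (k.drop i).zip (u.drop i) := List.drop_zipWith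
  rw [h1, h2, h3, h4, projLow_zip (by simp [hk]), projUp_zip (by simp [hk])]
  split_ifs <;> simp

/-- Powers of `dropOne` turn into powers of `trim` under `theta`, and undoing the regularization
adds a second sum. The result is unchanged when `u` and `v` are exchanged together with `i` and `l`.
-/
lemma extension_zipWord_theta (hc : ∀ w, ∀ v ∈ H0, c (w * v) = c (sh w v)) {u v : List ℕ} {r : ℕ}
    (hu : u.length = r) (hv : v.length = r) : extension c hc (zipWord u (theta (word v)))
      = ∑ i ∈ Finset.range (r + 1), ∑ l ∈ Finset.range (r + 1),
        if i + l ≤ r then c (word (List.replicate (r - i - l) 1))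
          * (lowReg c ((trim ^ (r - i)) (word u)) * lowReg c ((trim ^ (r - l)) (word v)))
        else 0 := by
  rw [extension_zipWord c hc u (by rw [hu, ← hv]; exact theta_word_mem_span_length v), hu]
  refine Finset.sum_congr rfl fun i hi => ?_
  have hi : i ≤ r := Nat.lt_succ_iff.1 (Finset.mem_range.1 hi)
  have hN : (trim ^ (r - i + 1)) ((trim ^ i) (word v)) = 0 := by
    have := trim_pow_length_succ v
    rw [← Module.End.mul_apply, ← pow_add]
    convert this using 3
    omega
  -- Reflecting the inner sum makes `l` the complement of `i` plus the number of extracted letters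
  -- `z_1`, so that this number becomes `r - i - l`.
  rw [dropOne_pow_theta, map_theta_eq_sum c hc _ _ hN, ← Finset.sum_range_reflect,
    Finset.mul_sum]
  have hsub : Finset.range (r - i + 1) ⊆ Finset.range (r + 1) := Finset.range_mono (by omega)
  rw [← Finset.sum_subset hsub fun l _ hl => if_neg (by
    have := Finset.mem_range.not.1 hl
    omega)]
  refine Finset.sum_congr rfl fun l hl => ?_
  have hl := Finset.mem_range.1 hl
  rw [if_pos (by omega), ← Module.End.mul_apply, ← pow_add]
  have e1 : r - i + 1 - 1 - l = r - i - l := by omega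
  have e2 : r - i - l + i = r - l := by omega
  rw [e1, e2]
  ring

/-- Since `theta` is surjective in each length, the elements `zipWord u (theta v)` span; the swap
exchanges `u` and `v`, and the double sum for the extension is symmetric. -/
lemma extension_swap (hc : ∀ w, ∀ v ∈ H0, c (w * v) = c (sh w v)) (x : QA) :
    extension c hc (swap x) = extension c hc x := by
  have key : ∀ u v : List ℕ, u.length = v.length →
      extension c hc (swap (zipWord u (theta (word v))))
      = extension c hc (zipWord u (theta (word v))) := by
    intro u v h
    rw [swap_zipWord_theta h, extension_zipWord_theta c hc rfl h,
      extension_zipWord_theta c hc h rfl, Finset.sum_comm]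
    refine Finset.sum_congr rfl fun i _ => Finset.sum_congr rfl fun l _ => ?_
    rw [add_comm l i, Nat.sub_right_comm, mul_comm (lowReg c ((trim ^ (v.length - l)) _))]
  have h : (extension c hc).toLinearMap.comp swap = (extension c hc).toLinearMap := by
    refine hom_ext fun w => ?_
    have hw : word w = zipWord (w.map Prod.snd) (word (w.map Prod.fst)) := by
      rw [zipWord, lift_word, List.zip_map']
      simp
    rw [hw]
    refine LinearMap.eqOn_span
      (f := ((extension c hc).toLinearMap.comp swap).comp (zipWord (w.map Prod.snd)))
      (g := (extension c hc).toLinearMap.comp (zipWord (w.map Prod.snd))) ?_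
      (word_mem_span_theta_length (w.map Prod.fst))
    rintro _ ⟨v, hv, rfl⟩
    exact key _ v (by simpa using hv.symm)
  exact congrArg (fun f => f x) h

end Realization

/-! ### The two inclusions. -/

/-- The ideal of the extended double shuffle relations. -/
def doubleShuffleIdeal : Ideal H1 :=
  Ideal.span {x : H1 | ∃ w v : H1, v ∈ H0 ∧ x = w * v - sh w v}

/-- The extension is applied to the universal realization, the projection modulo the relations. An
element of the kernel becomes, in `ℚ⟨𝒜⟩`, congruent to an element of `𝔑` modulo the swap ideal. The
extension kills both ideals and restricts to the projection on `𝔥¹`. -/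
lemma ker_zetaF_le : RingHom.ker zetaF ≤ doubleShuffleIdeal := by
  intro x hx
  let c : H1 →ₐ[ℚ] H1 ⧸ doubleShuffleIdeal := Ideal.Quotient.mkₐ ℚ doubleShuffleIdeal
  have hc : ∀ w, ∀ v ∈ H0, c (w * v) = c (sh w v) := fun w v hv =>
    Ideal.Quotient.eq.2 (Ideal.subset_span ⟨w, v, hv, rfl⟩)
  have hswap : swapIdeal ≤ RingHom.ker (extension c hc) := by
    refine Ideal.span_le.2 ?_
    rintro _ ⟨w, rfl⟩
    rw [SetLike.mem_coe, RingHom.mem_ker, map_sub, extension_swap, sub_self]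
  have hN : idealN ≤ RingHom.ker (extension c hc) := by
    refine Ideal.span_le.2 ?_
    rintro _ ⟨w, hw, rfl⟩
    exact extension_of_not_isZetaWord c hc hw
  have hx' : Ideal.Quotient.mk swapIdeal (inclQA x)
      ∈ idealN.map (Ideal.Quotient.mk swapIdeal) := Ideal.Quotient.eq_zero_iff_mem.1 hx
  obtain ⟨y, hy, hxy⟩ :=
    (Ideal.mem_map_iff_of_surjective _ Ideal.Quotient.mk_surjective).1 hx'
  have hsub : y - inclQA x ∈ RingHom.ker (extension c hc) := hswap (Ideal.Quotient.eq.1 hxy)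
  have hker : extension c hc (inclQA x) = 0 := by
    have := (Submodule.sub_mem_iff_right _ (hN hy)).1 hsub
    exact this
  rw [extension_inclQA] at hker
  exact Ideal.Quotient.eq_zero_iff_mem.1 hker

lemma le_ker_zetaF : doubleShuffleIdeal ≤ RingHom.ker zetaF := by
  refine Ideal.span_le.2 ?_
  rintro _ ⟨w, v, hv, rfl⟩
  rw [SetLike.mem_coe, RingHom.mem_ker, map_sub, zetaF_mul_eq_sh w v hv, sub_self]

end FormalMZV
end

/-- The kernel of the stuffle homomorphism `ζ^f : 𝔥¹ → Z^f` is the ideal of `(𝔥¹, ∗)` generated by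
the elements `w ∗ v - w ⧢ v` with `w ∈ 𝔥¹` and `v ∈ 𝔥⁰`. -/
theorem mainTheorem2 :
    RingHom.ker FormalMZV.zetaF =
      Ideal.span {x : FormalMZV.H1 |
        ∃ w v : FormalMZV.H1, v ∈ FormalMZV.H0 ∧ x = w * v - FormalMZV.sh w v} :=
  le_antisymm FormalMZV.ker_zetaF_le FormalMZV.le_ker_zetaF
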